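/- Let $M$ be a smooth manifold. Write $p,p_*:T^2M=T(TM)\to TM$ for the projection of the tangent bundle of $TM$ and for the differential of $TM\to M$, and $\kappa:T^2M\to T^2M$ for the canonical involution, given in induced coordinates by $\kappa(x,X,Y,\mathcal Z)=(x,Y,X,\mathcal Z)$. If $\mathcal X_1,\mathcal X_2\in T^2M$ lie over $x\in M$ in the same fibre of $p\times p_*$, then $\pi(\mathcal X_1,\mathcal X_2)\in T_xM$ is the vector $V$ for which $\mathcal X_1-\mathcal X_2$, computed in the vector space $T_{p(\mathcal X_2)}TM$, is the velocity at $t=0$ of $t\mapsto p(\mathcal X_2)+tV$. A $(1,1)$-jet from $x$ to $y$ is the first order jet $j^1_xb$ at $x$ of a smooth family $z\mapsto b(z)$ of linear isomorphisms $b(z):T_zM\to T_{f(z)}M$, defined for $z$ near $x$, where $f$ is a local diffeomorphism with $f(x)=y$. Put $p(j^1_xb)=b(x)$. The jet is semi-holonomic if $b(x)=f_{*x}$, and it is holonomic (a genuine $2$-jet) if it is the jet at $x$ of some family $z\mapsto f_{*z}$ with $f$ a local diffeomorphism. It acts on $T^2M$ over $x$ by $j^1_xb\cdot\frac{dX_t}{dt}\big|_0=\frac{d(b\cdot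 X_t)}{dt}\big|_0$, where $b\cdot X_z=b(z)X_z$. For a semi-holonomic jet $j$ the jet $\kappa(j)$ is defined by $\kappa(j)\cdot\mathcal X=\kappa(j\cdot\kappa(\mathcal X))$. Let $\nabla$ be an affine connection on $M$ with torsion $T(X,Y)=\nabla_XY-\nabla_YX-[X,Y]$. A semi-holonomic jet $j^1_xb$ is called affine if $b(x)(\nabla_{X_x}Y)=\nabla_{b(x)X_x}(bY)$ for every $X_x\in T_xM$ and every vector field $Y$ near $x$, where $(bY)_{f(z)}=b(z)Y_z$. 1. Every linear isomorphism $\xi:T_xM\to T_yM$, $x,y\in M$, has exactly one affine extension, that is, there is exactly one affine jet $S(\xi)$ with $p(S(\xi))=\xi$. 2. For every such $\xi$ and every $\mathcal X\in T^2M$ with $p(\mathcal X)=Y_x$ and $p_*(\mathcal X)=X_x$, the elements $S(\xi)\cdot\mathcal X$ and $\kappa(S(\xi))\cdot\mathcal X$ lie in the same fibre of $p\times p_*$ and $$\pi\bigl(S(\xi)\cdot\mathcal X,\ \kappa(S(\xi))\cdot\mathcal X\bigr)=\xi\bigl(T(X_x,Y_x)\bigr)-T\bigl(\xi X_x,\xi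 Y_x\bigr).$$ In particular, $S(\xi)$ is holonomic if and only if $\xi$ preserves the torsion, i.e. $\xi(T(X,Y))=T(\xi X,\xi Y)$ for all $X,Y\in T_xM$. 3. Let $\mathfrak s$ be a symmetry jet, i.e. a smooth section $x\mapsto\mathfrak s(x)=j^1_xs_x$ of the semi-holonomic $(1,1)$-jets from $x$ to $x$ with $p(\mathfrak s(x))=-\mathrm{id}_{T_xM}$, and suppose that $\nabla$ is the connection of $\mathfrak s$, i.e. $(\nabla_XY)_x=\tfrac12[X,Y+s_x(Y)]_x$ for all vector fields $X,Y$ near $x$, where $s_x(Y)$ is the local vector field obtained from $Y$ by the family $s_x$ (as $bY$ above). Then for every $\mathcal X\in T^2M$ with $p(\mathcal X)=Y_x$ and $p_*(\mathcal X)=X_x$, the elements $\kappa(\mathfrak s(x))\cdot\mathcal X$ and $\mathfrak s(x)\cdot\mathcal X$ lie in the same fibre of $p\times p_*$ and $$T(X_x,Y_x)=\tfrac12\,\pi\bigl(\kappa(\mathfrak s(x))\cdot\mathcal X,\ \mathfrak s(x)\cdot\mathcal X\bigr).$$ -/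

import Mathlib

open scoped Manifold ContDiff Topology
open Bundle

noncomputable section

namespace AffineJet

variable {E : Type*} [NormedAddCommGroup E] [NormedSpace ℝ E]
variable {M : Type*} [TopologicalSpace M] [ChartedSpace E M] [IsManifold 𝓘(ℝ, E) ∞ M]

/-! ### The fibres of the second tangent bundle

In Mathlib `TangentSpace I x` is the model vector space `E`, the vector `v : E` standing for the
tangent vector at `x` whose components in the preferred chart at `x` are `v`. Likewise a tangent
vector to `TM` at `⟨x, v⟩` is a pair in `E × E`, its components in the chart of `TM` induced by the
preferred chart at `x`. -/

/-- The fibre `T²_x M` over `x` of the projection `T²M → M`: the pairs consisting of `v ∈ T_x M`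
and of a tangent vector to the manifold `TM` at `v`. -/
abbrev T2 (E : Type*) [NormedAddCommGroup E] [NormedSpace ℝ E]
    {M : Type*} [TopologicalSpace M] [ChartedSpace E M] [IsManifold 𝓘(ℝ, E) ∞ M] (x : M) : Type _ :=
  (v : TangentSpace 𝓘(ℝ, E) x) ×
    TangentSpace 𝓘(ℝ, E).tangent (⟨x, v⟩ : TangentBundle 𝓘(ℝ, E) M)

theorem extChartAt_tangent (p q : TangentBundle 𝓘(ℝ, E) M) :
    extChartAt 𝓘(ℝ, E).tangent p q =
      (extChartAt 𝓘(ℝ, E) p.proj q.proj, (trivializationAt E (TangentSpace 𝓘(ℝ, E)) p.proj q).2) := rfl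

theorem extChartAt_tangent_symm (p : TangentBundle 𝓘(ℝ, E) M) (q : E × E)
    (hq : q.1 ∈ (extChartAt 𝓘(ℝ, E) p.proj).target) :
    (extChartAt 𝓘(ℝ, E).tangent p).symm q =
      ⟨(extChartAt 𝓘(ℝ, E) p.proj).symm q.1, (trivializationAt E (TangentSpace 𝓘(ℝ, E)) p.proj).symm ((extChartAt 𝓘(ℝ, E) p.proj).symm q.1) q.2⟩ := by
  rw [Trivialization.mk_symm]
  · rfl
  · have := (extChartAt 𝓘(ℝ, E) p.proj).map_target hq
    simpa [extChartAt_source] using this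

theorem trivializationAt_self (x : M) (v : TangentSpace 𝓘(ℝ, E) x) :
    (trivializationAt E (TangentSpace 𝓘(ℝ, E)) x (⟨x, v⟩ : TangentBundle 𝓘(ℝ, E) M)).2 =
      (show E from v) :=
  (tangentBundleCore 𝓘(ℝ, E) M).coordChange_self (achart E x) x (mem_chart_source E x) v

namespace T2

variable {x : M}

/-- The point of the total space `T²M = T(TM)` given by an element of the fibre `T²_x M`. -/
def toTotal (𝒳 : T2 E x) : TangentBundle 𝓘(ℝ, E).tangent (TangentBundle 𝓘(ℝ, E) M) :=
  ⟨⟨x, 𝒳.1⟩, 𝒳.2⟩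

/-- The element of the fibre `T²_x M` given by a point of the total space `T²M` over `x`. -/
def ofTotal (𝒳 : TangentBundle 𝓘(ℝ, E).tangent (TangentBundle 𝓘(ℝ, E) M)) : T2 E 𝒳.proj.proj :=
  ⟨𝒳.proj.snd, 𝒳.snd⟩

/-- The projection `p : T²M → TM` of the tangent bundle of `TM`. -/
def p (𝒳 : T2 E x) : TangentSpace 𝓘(ℝ, E) x := 𝒳.1

/-- The projection `p_* : T²M → TM`, the differential of the projection `TM → M`. -/
def pStar (𝒳 : T2 E x) : TangentSpace 𝓘(ℝ, E) x :=
  mfderiv 𝓘(ℝ, E).tangent 𝓘(ℝ, E) (fun q : TangentBundle 𝓘(ℝ, E) M => q.proj) ⟨x, 𝒳.1⟩ 𝒳.2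

/-- The canonical involution `κ`. If `(xⁱ)` are the coordinates of the preferred chart at `x`, then
the element `⟨v, (a, c)⟩` has coordinates `(x, v, a, c)` in the induced coordinates on `T²M`
(see `extChartAt_toTotal`), and `κ` flips the two middle ones. -/
def kappa (𝒳 : T2 E x) : T2 E x :=
  ⟨Prod.fst (α := E) (β := E) 𝒳.2, Prod.mk (α := E) (β := E) 𝒳.1 (Prod.snd (α := E) (β := E) 𝒳.2)⟩

/-- The vector tangent to the fibre `T_x M ⊆ TM` at the point `v` which is determined by
`V ∈ T_x M`, that is, the velocity at `t = 0` of `t ↦ v + t V`. -/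
def verticalLift (v V : TangentSpace 𝓘(ℝ, E) x) :
    TangentSpace 𝓘(ℝ, E).tangent (⟨x, v⟩ : TangentBundle 𝓘(ℝ, E) M) :=
  mfderiv 𝓘(ℝ, E) 𝓘(ℝ, E).tangent (fun u : E => (⟨x, u⟩ : TangentBundle 𝓘(ℝ, E) M)) v V

/-- The parametrization `V ↦ 𝒳 + (0_{p(𝒳)} +_* V)` by `T_x M` of the fibre of `p × p_*`
through `𝒳`. -/
def translate (𝒳 : T2 E x) (V : TangentSpace 𝓘(ℝ, E) x) : T2 E x :=
  ⟨𝒳.1, 𝒳.2 + verticalLift 𝒳.1 V⟩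

/-- The difference `π(𝒳₁, 𝒳₂) ∈ T_x M` of two elements of the same fibre of `p × p_*`: the vector
`V` such that `𝒳₁ = translate 𝒳₂ V`. (No meaning is attached to it for elements of different
fibres.) -/
def diff (𝒳₁ 𝒳₂ : T2 E x) : TangentSpace 𝓘(ℝ, E) x :=
  Classical.epsilon fun V => 𝒳₁ = translate 𝒳₂ V

theorem extChartAt_toTotal {x : M} (𝒳 : T2 E x) :
    extChartAt 𝓘(ℝ, E).tangent.tangent 𝒳.toTotal 𝒳.toTotal =
      ((extChartAt 𝓘(ℝ, E) x x, (show E from 𝒳.1)), (show E × E from 𝒳.2)) := by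
  have h1 : extChartAt 𝓘(ℝ, E).tangent.tangent 𝒳.toTotal 𝒳.toTotal = 
    (extChartAt 𝓘(ℝ, E).tangent 𝒳.toTotal.proj 𝒳.toTotal.proj, (trivializationAt (E × E) (TangentSpace 𝓘(ℝ, E).tangent) 𝒳.toTotal.proj 𝒳.toTotal).2) := rfl
  rw [h1, extChartAt_tangent]
  refine Prod.ext (Prod.ext rfl ?_) ?_
  · exact trivializationAt_self x 𝒳.1
  · exact (tangentBundleCore 𝓘(ℝ, E).tangent (TangentBundle 𝓘(ℝ, E) M)).coordChange_self (achart (ModelProd E E) _) _ (mem_chart_source _ _) 𝒳.2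

theorem verticalLift_eq {x : M} (v V : TangentSpace 𝓘(ℝ, E) x) :
    verticalLift v V = (show E × E from ((0 : E), (V : E))) := by
  have h0 : (fun u : E => extChartAt 𝓘(ℝ, E).tangent (⟨x, v⟩ : TangentBundle 𝓘(ℝ, E) M) ⟨x, u⟩) = fun u : E => (extChartAt 𝓘(ℝ, E) x x, u) := by
    funext u
    rw [extChartAt_tangent]
    exact Prod.ext rfl (trivializationAt_self x u)
  have h : HasMFDerivAt 𝓘(ℝ, E) 𝓘(ℝ, E).tangent
      (fun u : E => (⟨x, u⟩ : TangentBundle 𝓘(ℝ, E) M)) v (ContinuousLinearMap.inr ℝ E E) := by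
    constructor
    · exact (FiberBundle.totalSpaceMk_isInducing E (TangentSpace 𝓘(ℝ, E)) x).continuous.continuousAt
    · have : HasFDerivAt (fun u : E => (extChartAt 𝓘(ℝ, E) x x, u)) (ContinuousLinearMap.inr ℝ E E) (v : E) := by
        exact (hasFDerivAt_const _ _).prodMk (hasFDerivAt_id _)
      rw [← h0] at this
      exact this.hasFDerivWithinAt
  unfold verticalLift
  rw [h.mfderiv]
  rfl

theorem diff_translate (𝒳 : T2 E x) (V : TangentSpace 𝓘(ℝ, E) x) :
    diff (translate 𝒳 V) 𝒳 = V := by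
  have h : translate 𝒳 V = translate 𝒳 (diff (translate 𝒳 V) 𝒳) :=
    Classical.epsilon_spec (p := fun W => translate 𝒳 V = translate 𝒳 W) ⟨V, rfl⟩
  have h1 := eq_of_heq (Sigma.mk.inj h).2
  have h2 : verticalLift 𝒳.1 V = verticalLift 𝒳.1 (diff (translate 𝒳 V) 𝒳) :=
    add_left_cancel h1
  rw [verticalLift_eq, verticalLift_eq] at h2
  exact (congrArg (Prod.snd (α := E) (β := E)) h2).symm

/-- Two elements of `T²_x M` lie in the same fibre of `p × p_*`. -/
def SameFiber (𝒳₁ 𝒳₂ : T2 E x) : Prop :=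
  𝒳₁.p = 𝒳₂.p ∧ 𝒳₁.pStar = 𝒳₂.pStar

end T2

/-! ### Local bisections and `(1,1)`-jets -/

/-- The `1`-jets with source `z` of local diffeomorphisms of `M`: a target point `w` together with
a linear isomorphism `T_z M → T_w M`. -/
abbrev OneJet (E : Type*) [NormedAddCommGroup E] [NormedSpace ℝ E]
    {M : Type*} [TopologicalSpace M] [ChartedSpace E M] (z : M) : Type _ :=
  (w : M) × (TangentSpace 𝓘(ℝ, E) z ≃L[ℝ] TangentSpace 𝓘(ℝ, E) w)

/-- A family `z ↦ b(z)` of isomorphisms `T_z M → T_{f(z)} M`, read as a family of endomorphisms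
of `E` through the coordinates of `M` around `x` and around `f(x)`. -/
def coords (b : ∀ z : M, OneJet E z) (x : M) : M → E →L[ℝ] E :=
  inTangentCoordinates 𝓘(ℝ, E) 𝓘(ℝ, E) id (fun z => (b z).1)
    (fun z => ((b z).2 : TangentSpace 𝓘(ℝ, E) z →L[ℝ] TangentSpace 𝓘(ℝ, E) (b z).1)) x

/-- A local bisection, defined near `x`, of the groupoid of `1`-jets, with target `y` at `x`:
isomorphisms `b(z) : T_z M → T_{f(z)} M` depending smoothly on `z` near `x`, where `f` is a
diffeomorphism near `x` and `f(x) = y`. Only the values of `toFun` near `x` matter. -/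
structure LocalBisection (E : Type*) [NormedAddCommGroup E] [NormedSpace ℝ E]
    {M : Type*} [TopologicalSpace M] [ChartedSpace E M] [IsManifold 𝓘(ℝ, E) ∞ M] (x y : M) where
  /-- the map `z ↦ b(z)` -/
  toFun : ∀ z : M, OneJet E z
  /-- the value of `b` at `x` -/
  value : TangentSpace 𝓘(ℝ, E) x ≃L[ℝ] TangentSpace 𝓘(ℝ, E) y
  toFun_self : toFun x = ⟨y, value⟩
  isLocalDiffeomorphAt :
    IsLocalDiffeomorphAt 𝓘(ℝ, E) 𝓘(ℝ, E) ∞ (fun z => (toFun z).1) x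
  smooth : ∀ᶠ z in 𝓝 x, ContMDiffAt 𝓘(ℝ, E) 𝓘(ℝ, E →L[ℝ] E) ∞ (coords toFun x) z

namespace LocalBisection

variable {x y : M}

/-- The local diffeomorphism `f` underlying a local bisection. -/
def base (b : LocalBisection E x y) (z : M) : M := (b.toFun z).1

/-- The action `TM → TM, X_z ↦ b(z) X_z` of a local bisection on tangent vectors. -/
def actTM (b : LocalBisection E x y) (X : TangentBundle 𝓘(ℝ, E) M) : TangentBundle 𝓘(ℝ, E) M :=
  ⟨b.base X.proj, (b.toFun X.proj).2 X.snd⟩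

/-- The differential at `x` of the local diffeomorphism underlying a local bisection. (It has
values in the tangent space at `f(x)`, and `f(x) = y`.) -/
def deriv (b : LocalBisection E x y) : TangentSpace 𝓘(ℝ, E) x →L[ℝ] TangentSpace 𝓘(ℝ, E) y :=
  mfderiv 𝓘(ℝ, E) 𝓘(ℝ, E) b.base x

/-- The first order Taylor expansion at `x` of a local bisection in coordinates around `x` and
around `y`: its value at `x`, the differential of the underlying map, and the differential of
the matrix of `b(z)`. -/
def taylor (b : LocalBisection E x y) :
    (TangentSpace 𝓘(ℝ, E) x ≃L[ℝ] TangentSpace 𝓘(ℝ, E) y) ×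
      (TangentSpace 𝓘(ℝ, E) x →L[ℝ] TangentSpace 𝓘(ℝ, E) y) × (E →L[ℝ] E →L[ℝ] E) :=
  (b.value, b.deriv,
    mfderiv 𝓘(ℝ, E) 𝓘(ℝ, E →L[ℝ] E) (coords b.toFun x) x)

/-- The action of a local bisection on `T²_x M` obtained by differentiating its action on `TM`:
the velocity of `t ↦ X_t` is sent to the velocity of `t ↦ b · X_t`. (It has values over the point
`f(x) = y` of `M`.) -/
def actT2 (b : LocalBisection E x y) (𝒳 : T2 E x) : T2 E y :=
  ⟨b.value 𝒳.1,
    mfderiv 𝓘(ℝ, E).tangent 𝓘(ℝ, E).tangent b.actTM ⟨x, 𝒳.1⟩ 𝒳.2⟩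

/-- The local vector field `Z` near `y` is the image `b Y` of the vector field `Y`:
`Z(f(z)) = b(z) Y(z)` for `z` near `x`. -/
def IsImage (b : LocalBisection E x y) (Y Z : ∀ z : M, TangentSpace 𝓘(ℝ, E) z) : Prop :=
  ∀ᶠ z in 𝓝 x, Z (b.base z) = (b.toFun z).2 (Y z)

end LocalBisection

theorem LocalBisection.written_actTM {x y : M} (b : LocalBisection E x y)
    (v : TangentSpace 𝓘(ℝ, E) x) (q : E × E) (q1 : q.1 ∈ (extChartAt 𝓘(ℝ, E) x).target)
    (q3 : b.base ((extChartAt 𝓘(ℝ, E) x).symm q.1) ∈ (chartAt E (b.base x)).source) :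
    writtenInExtChartAt 𝓘(ℝ, E).tangent 𝓘(ℝ, E).tangent (⟨x, v⟩ : TangentBundle 𝓘(ℝ, E) M)
      b.actTM q = (writtenInExtChartAt 𝓘(ℝ, E) 𝓘(ℝ, E) x b.base q.1,
        coords b.toFun x ((extChartAt 𝓘(ℝ, E) x).symm q.1) q.2) := by
  have q2 : (extChartAt 𝓘(ℝ, E) x).symm q.1 ∈ (chartAt E x).source := by
    have := (extChartAt 𝓘(ℝ, E) x).map_target q1
    rwa [extChartAt_source] at this
  have e1 : writtenInExtChartAt 𝓘(ℝ, E).tangent 𝓘(ℝ, E).tangent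
      (⟨x, v⟩ : TangentBundle 𝓘(ℝ, E) M) b.actTM q =
      extChartAt 𝓘(ℝ, E).tangent (b.actTM ⟨x, v⟩)
        (b.actTM ((extChartAt 𝓘(ℝ, E).tangent (⟨x, v⟩ : TangentBundle 𝓘(ℝ, E) M)).symm q)) := rfl
  have e2 := congrArg (fun z => extChartAt 𝓘(ℝ, E).tangent (b.actTM ⟨x, v⟩) (b.actTM z))
    (extChartAt_tangent_symm (⟨x, v⟩ : TangentBundle 𝓘(ℝ, E) M) q q1)
  refine (e1.trans e2).trans ?_
  refine (extChartAt_tangent _ _).trans ?_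
  generalize hz : (extChartAt 𝓘(ℝ, E) x).symm q.1 = z at *
  have e3 : writtenInExtChartAt 𝓘(ℝ, E) 𝓘(ℝ, E) x b.base q.1 =
    extChartAt 𝓘(ℝ, E) (b.base x) (b.base z) := by rw [← hz]; rfl
  have e4 : coords b.toFun x z q.2 = (trivializationAt E (TangentSpace 𝓘(ℝ, E)) (b.base x)
      (b.actTM ⟨z, (trivializationAt E (TangentSpace 𝓘(ℝ, E)) x).symm z q.2⟩)).2 := by
    simp only [coords, inTangentCoordinates, ContinuousLinearMap.inCoordinates]
    rw [ContinuousLinearMap.comp_apply, ContinuousLinearMap.comp_apply,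
      Trivialization.symmL_apply _ q2, Trivialization.continuousLinearMapAt_apply,
      Trivialization.linearMapAt_apply]
    exact if_pos q3
  rw [e3, e4]
  rfl

theorem LocalBisection.base_self {x y : M} (b : LocalBisection E x y) : b.base x = y :=
  congrArg Sigma.fst b.toFun_self

theorem LocalBisection.actTM_self {x y : M} (b : LocalBisection E x y)
    (v : TangentSpace 𝓘(ℝ, E) x) : b.actTM ⟨x, v⟩ = ⟨y, b.value v⟩ := by
  have h : ∀ g : OneJet E x, g = ⟨y, b.value⟩ →
      (⟨g.1, g.2 v⟩ : TangentBundle 𝓘(ℝ, E) M) = ⟨y, b.value v⟩ := by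
    rintro g rfl; rfl
  exact h _ b.toFun_self

theorem LocalBisection.coords_self {x y : M} (b : LocalBisection E x y) (v : E) :
    coords b.toFun x x v = (show E from b.value v) := by
  have h := trivializationAt_self (b.base x) ((b.toFun x).2 v)
  have e4 : coords b.toFun x x v = (trivializationAt E (TangentSpace 𝓘(ℝ, E)) (b.base x)
      (b.actTM ⟨x, v⟩)).2 := by
    simp only [coords, inTangentCoordinates, ContinuousLinearMap.inCoordinates]
    rw [ContinuousLinearMap.comp_apply, ContinuousLinearMap.comp_apply,
      Trivialization.continuousLinearMapAt_apply,
      Trivialization.linearMapAt_apply]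
    refine (if_pos (mem_chart_source E (b.base x))).trans ?_
    have e5 : (trivializationAt E (TangentSpace 𝓘(ℝ, E)) x).symm x v = (v : E) := by
      have h6 := (trivializationAt E (TangentSpace 𝓘(ℝ, E)) x).apply_mk_symm
        (mem_chart_source E x) v
      have h7 := trivializationAt_self x ((trivializationAt E (TangentSpace 𝓘(ℝ, E)) x).symm x v)
      exact h7.symm.trans (congrArg Prod.snd h6)
    have e6 : (Trivialization.symmL ℝ (trivializationAt E (TangentSpace 𝓘(ℝ, E)) (id x)) (id x)) v
        = (v : E) :=
      (Trivialization.symmL_apply (R := ℝ) (trivializationAt E (TangentSpace 𝓘(ℝ, E)) x)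
        (mem_chart_source E x) v).trans e5
    exact congrArg (fun w : E => (trivializationAt E (TangentSpace 𝓘(ℝ, E)) (b.base x)
      (b.actTM ⟨x, w⟩)).2) e6
  rw [e4, b.actTM_self v]
  have h' : b.base x = y := b.base_self
  rw [h']
  exact trivializationAt_self y _

theorem hasFDerivAt_pair {F : E → E} {C : E → E →L[ℝ] E} {a : E} {A C₀ : E →L[ℝ] E}
    {B : E →L[ℝ] E →L[ℝ] E} (v : E) (hF : HasFDerivAt F A a) (hC : HasFDerivAt C B a)
    (hC₀ : ∀ w, C a w = C₀ w) :
    HasFDerivAt (fun q : E × E => (F q.1, C q.1 q.2))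
      ((A.comp (ContinuousLinearMap.fst ℝ E E)).prod
        ((B.flip v).comp (ContinuousLinearMap.fst ℝ E E) +
          C₀.comp (ContinuousLinearMap.snd ℝ E E))) (a, v) := by
  have hf : HasFDerivAt (Prod.fst : E × E → E) (ContinuousLinearMap.fst ℝ E E) (a, v) :=
    hasFDerivAt_fst
  have hg : HasFDerivAt (Prod.snd : E × E → E) (ContinuousLinearMap.snd ℝ E E) (a, v) :=
    hasFDerivAt_snd
  refine ((hF.comp (a, v) hf).prodMk ((hC.comp (a, v) hf).clm_apply hg)).congr_fderiv ?_
  ext w <;> simp [hC₀]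

/-- The coordinate expression of the differential of `actTM`. -/
def LocalBisection.actTMDeriv {x y : M} (b : LocalBisection E x y) (v : E) : E × E →L[ℝ] E × E :=
  let A : E →L[ℝ] E := b.deriv
  let C : E →L[ℝ] E := (b.value : TangentSpace 𝓘(ℝ, E) x →L[ℝ] TangentSpace 𝓘(ℝ, E) y)
  (A.comp (ContinuousLinearMap.fst ℝ E E)).prod
    ((b.taylor.2.2.flip v).comp (ContinuousLinearMap.fst ℝ E E) +
      C.comp (ContinuousLinearMap.snd ℝ E E))

theorem LocalBisection.hasMFDerivAt_actTM {x y : M} (b : LocalBisection E x y)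
    (v : TangentSpace 𝓘(ℝ, E) x) :
    HasMFDerivAt 𝓘(ℝ, E).tangent 𝓘(ℝ, E).tangent b.actTM ⟨x, v⟩ (b.actTMDeriv v) := by
  have hb : MDifferentiableAt 𝓘(ℝ, E) 𝓘(ℝ, E) b.base x :=
    b.isLocalDiffeomorphAt.mdifferentiableAt (by simp)
  have hc : MDifferentiableAt 𝓘(ℝ, E) 𝓘(ℝ, E →L[ℝ] E) (coords b.toFun x) x :=
    b.smooth.self_of_nhds.mdifferentiableAt (by simp)
  have h2 : ∀ᶠ u : E in 𝓝 (extChartAt 𝓘(ℝ, E) x x), u ∈ (extChartAt 𝓘(ℝ, E) x).target ∧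
      b.base ((extChartAt 𝓘(ℝ, E) x).symm u) ∈ (chartAt E (b.base x)).source := by
    refine Filter.Eventually.and (extChartAt_target_mem_nhds (I := 𝓘(ℝ, E)) x) ?_
    have : ContinuousAt (fun u => b.base ((extChartAt 𝓘(ℝ, E) x).symm u))
        (extChartAt 𝓘(ℝ, E) x x) := by
      refine ContinuousAt.comp (g := b.base) ?_ (continuousAt_extChartAt_symm x)
      simpa using hb.continuousAt
    apply this.eventually_mem
    simpa using chart_source_mem_nhds E (b.base x)
  have h1 : ∀ᶠ q : E × E in 𝓝 ((extChartAt 𝓘(ℝ, E) x x, v) : E × E),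
      q.1 ∈ (extChartAt 𝓘(ℝ, E) x).target ∧
      b.base ((extChartAt 𝓘(ℝ, E) x).symm q.1) ∈ (chartAt E (b.base x)).source :=
    (continuousAt_fst (p := ((extChartAt 𝓘(ℝ, E) x x, v) : E × E))).eventually h2
  have hw := h1.mono fun q hq => b.written_actTM v q hq.1 hq.2
  have hb1 : HasFDerivAt (writtenInExtChartAt 𝓘(ℝ, E) 𝓘(ℝ, E) x b.base)
      (id (α := E →L[ℝ] E) b.deriv) (extChartAt 𝓘(ℝ, E) x x) := by
    have h := hb.hasMFDerivAt.2
    simp only [modelWithCornersSelf_coe, Set.range_id] at h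
    exact HasFDerivWithinAt.hasFDerivAt_of_univ h
  have hc1 : HasFDerivAt (fun u : E => coords b.toFun x ((extChartAt 𝓘(ℝ, E) x).symm u))
      b.taylor.2.2 (extChartAt 𝓘(ℝ, E) x x) := by
    have h := hc.hasMFDerivAt.2
    simp only [modelWithCornersSelf_coe, Set.range_id] at h
    exact HasFDerivWithinAt.hasFDerivAt_of_univ h
  have hmod := hasFDerivAt_pair (v : E) hb1 hc1
    (C₀ := id (α := E →L[ℝ] E) (b.value : TangentSpace 𝓘(ℝ, E) x →L[ℝ] TangentSpace 𝓘(ℝ, E) y)) (fun w => by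
      rw [extChartAt_to_inv]
      exact b.coords_self w)
  have hmod2 := hmod.congr_of_eventuallyEq hw
  have hbase : extChartAt 𝓘(ℝ, E).tangent (⟨x, v⟩ : TangentBundle 𝓘(ℝ, E) M) ⟨x, v⟩ =
      ((extChartAt 𝓘(ℝ, E) x x, v) : E × E) := by
    rw [extChartAt_tangent]
    exact Prod.ext rfl (trivializationAt_self x v)
  refine ⟨?_, ?_⟩
  · have hp : ContinuousAt (fun q : TangentBundle 𝓘(ℝ, E) M => q.proj) ⟨x, v⟩ :=
      (FiberBundle.continuous_proj E (TangentSpace 𝓘(ℝ, E))).continuousAt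
    refine (FiberBundle.continuousAt_totalSpace E _).2 ⟨?_, ?_⟩
    · exact ContinuousAt.comp (g := b.base) hb.continuousAt hp
    · have h3 : ContinuousAt (writtenInExtChartAt 𝓘(ℝ, E).tangent 𝓘(ℝ, E).tangent
          (⟨x, v⟩ : TangentBundle 𝓘(ℝ, E) M) b.actTM)
          (extChartAt 𝓘(ℝ, E).tangent (⟨x, v⟩ : TangentBundle 𝓘(ℝ, E) M) ⟨x, v⟩) := by
        rw [hbase]
        exact hmod2.continuousAt
      have h4 := h3.comp
        (continuousAt_extChartAt (I := 𝓘(ℝ, E).tangent) (⟨x, v⟩ : TangentBundle 𝓘(ℝ, E) M))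
      refine (continuousAt_snd.comp h4).congr ?_
      filter_upwards [extChartAt_source_mem_nhds (I := 𝓘(ℝ, E).tangent)
        (⟨x, v⟩ : TangentBundle 𝓘(ℝ, E) M)] with q hq
      have h5 := congrArg (fun z => (extChartAt 𝓘(ℝ, E).tangent (b.actTM ⟨x, v⟩) (b.actTM z)).2)
        ((extChartAt 𝓘(ℝ, E).tangent (⟨x, v⟩ : TangentBundle 𝓘(ℝ, E) M)).left_inv hq)
      exact h5
  · rw [hbase]
    exact hmod2.hasFDerivWithinAt

theorem LocalBisection.actT2_congr {x y : M} (b₁ b₂ : LocalBisection E x y)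
    (h : b₁.taylor = b₂.taylor) : b₁.actT2 = b₂.actT2 := by
  have hv : b₁.value = b₂.value := congrArg Prod.fst h
  have hd : b₁.deriv = b₂.deriv := congrArg (fun t => t.2.1) h
  funext 𝒳
  have hD : b₁.actTMDeriv 𝒳.1 = b₂.actTMDeriv 𝒳.1 := by
    simp only [LocalBisection.actTMDeriv, hv, hd, h]
  have e : ∀ b : LocalBisection E x y,
      b.actT2 𝒳 = ⟨b.value 𝒳.1, b.actTMDeriv 𝒳.1 𝒳.2⟩ := by
    intro b
    unfold LocalBisection.actT2
    rw [(b.hasMFDerivAt_actTM 𝒳.1).mfderiv]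
    rfl
  rw [e, e, hD, hv]

/-- Two local bisections are identified when they have the same value and the same first order
Taylor expansion at `x`. -/
def jetSetoid (E : Type*) [NormedAddCommGroup E] [NormedSpace ℝ E]
    {M : Type*} [TopologicalSpace M] [ChartedSpace E M] [IsManifold 𝓘(ℝ, E) ∞ M] (x y : M) :
    Setoid (LocalBisection E x y) :=
  Setoid.ker LocalBisection.taylor

/-- The `(1,1)`-jets with source `x` and target `y`: the `1`-jets `j¹_x b` at `x` of the local
bisections `b` of the groupoid of `1`-jets. -/
def Jet11 (E : Type*) [NormedAddCommGroup E] [NormedSpace ℝ E]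
    {M : Type*} [TopologicalSpace M] [ChartedSpace E M] [IsManifold 𝓘(ℝ, E) ∞ M] (x y : M) :
    Type _ :=
  Quotient (jetSetoid E x y)

/-- The `(1,1)`-jet `j¹_x b`. -/
def LocalBisection.jet {x y : M} (b : LocalBisection E x y) : Jet11 E x y :=
  Quotient.mk (jetSetoid E x y) b

namespace Jet11

variable {x y : M}

/-- The first order part `p(j¹_x b) = b(x)`. -/
def p (j : Jet11 E x y) : TangentSpace 𝓘(ℝ, E) x ≃L[ℝ] TangentSpace 𝓘(ℝ, E) y :=
  Quotient.lift LocalBisection.value (fun _ _ h => congrArg Prod.fst h) j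

/-- The projection `p_*(j¹_x b) = j¹_x f`, where `f` is the local diffeomorphism underlying `b`. -/
def pStar (j : Jet11 E x y) : TangentSpace 𝓘(ℝ, E) x →L[ℝ] TangentSpace 𝓘(ℝ, E) y :=
  Quotient.lift LocalBisection.deriv (fun _ _ h => congrArg (fun t => t.2.1) h) j

/-- A `(1,1)`-jet is semi-holonomic when `p(j) = p_*(j)`. -/
def IsSemiholonomic (j : Jet11 E x y) : Prop :=
  (j.p : TangentSpace 𝓘(ℝ, E) x →L[ℝ] TangentSpace 𝓘(ℝ, E) y) = j.pStar

/-- The action `𝒳 ↦ j · 𝒳` of a `(1,1)`-jet on `T²M`. -/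
def act (j : Jet11 E x y) : T2 E x → T2 E y :=
  Quotient.lift LocalBisection.actT2 (fun b₁ b₂ h => b₁.actT2_congr b₂ h) j

/-- The action of `κ(j)`, namely `κ(j) · 𝒳 = κ(j · κ(𝒳))`. -/
def kappaAct (j : Jet11 E x y) (𝒳 : T2 E x) : T2 E y :=
  (j.act 𝒳.kappa).kappa

/-- A `(1,1)`-jet is holonomic (a `2`-jet `j²_x f`) when it is the `1`-jet at `x` of the bisection
`z ↦ j¹_z f` given by a local diffeomorphism `f`. -/
def IsHolonomic (j : Jet11 E x y) : Prop :=
  ∃ b : LocalBisection E x y, b.jet = j ∧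
    ∀ᶠ z in 𝓝 x, ((b.toFun z).2 :
        TangentSpace 𝓘(ℝ, E) z →L[ℝ] TangentSpace 𝓘(ℝ, E) (b.toFun z).1) =
      mfderiv 𝓘(ℝ, E) 𝓘(ℝ, E) b.base z

end Jet11

/-! ### Affine jets and symmetry jets -/

/-- The vector field `Y` is smooth on a neighbourhood of `x`. -/
def SmoothNear (Y : ∀ z : M, TangentSpace 𝓘(ℝ, E) z) (x : M) : Prop :=
  ∀ᶠ z in 𝓝 x, ContMDiffAt 𝓘(ℝ, E) 𝓘(ℝ, E).tangent ∞
    (fun z => (⟨z, Y z⟩ : TangentBundle 𝓘(ℝ, E) M)) z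

/-- Affine connections on `M`; `D Y x X` is `∇_X Y` for `X ∈ T_x M`. -/
abbrev Connection (E : Type*) [NormedAddCommGroup E] [NormedSpace ℝ E]
    (M : Type*) [TopologicalSpace M] [ChartedSpace E M] [IsManifold 𝓘(ℝ, E) ∞ M] : Type _ :=
  CovariantDerivative 𝓘(ℝ, E) E (TangentSpace 𝓘(ℝ, E) : M → Type _)

/-- A `(1,1)`-jet `j¹_x b` is affine when it is semi-holonomic and
`b(x) (∇_X Y) = ∇_{b(x) X} (b Y)` for all `X ∈ T_x M` and all vector fields `Y` near `x`. -/
def IsAffine (D : Connection E M) {x y : M} (j : Jet11 E x y) : Prop :=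
  j.IsSemiholonomic ∧ ∃ b : LocalBisection E x y, b.jet = j ∧
    ∀ Y Z : ∀ z : M, TangentSpace 𝓘(ℝ, E) z, SmoothNear Y x → b.IsImage Y Z →
      ∀ X : TangentSpace 𝓘(ℝ, E) x, j.p (D Y x X) = D Z y (j.p X)

/-- A symmetry jet: a smooth section `x ↦ 𝔰(x)` of the semi-holonomic `(1,1)`-jets over the
identity of `M` with first order part `-id`. Smoothness is expressed by the map
`𝒳 ↦ 𝔰(x) · 𝒳` on `T²M`. -/
structure SymmetryJet (E : Type*) [NormedAddCommGroup E] [NormedSpace ℝ E]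
    (M : Type*) [TopologicalSpace M] [ChartedSpace E M] [IsManifold 𝓘(ℝ, E) ∞ M] where
  /-- the jet `𝔰(x)` -/
  toFun : ∀ x : M, Jet11 E x x
  isSemiholonomic : ∀ x, (toFun x).IsSemiholonomic
  p_apply : ∀ (x : M) (X : TangentSpace 𝓘(ℝ, E) x), (toFun x).p X = -X
  smooth : ContMDiff 𝓘(ℝ, E).tangent.tangent 𝓘(ℝ, E).tangent.tangent ∞
    (fun 𝒳 : TangentBundle 𝓘(ℝ, E).tangent (TangentBundle 𝓘(ℝ, E) M) =>
      ((toFun 𝒳.proj.proj).act (T2.ofTotal 𝒳)).toTotal)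

/-- `D` is the affine connection of the symmetry jet `𝔰`:
`(∇_X Y)_x = ½ [X, Y + s_x(Y)]_x`, where `𝔰(x) = j¹_x s_x`. -/
def SymmetryJet.Induces (s : SymmetryJet E M) (D : Connection E M) : Prop :=
  ∀ x : M, ∃ b : LocalBisection E x x, b.jet = s.toFun x ∧
    ∀ X Y Z : ∀ z : M, TangentSpace 𝓘(ℝ, E) z, SmoothNear X x → SmoothNear Y x →
      b.IsImage Y Z →
        D Y x (X x) = (1 / 2 : ℝ) • VectorField.mlieBracket 𝓘(ℝ, E) X (fun z => Y z + Z z) x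

end AffineJet

end

open AffineJet

noncomputable section

namespace AffineJet

variable {E : Type*} [NormedAddCommGroup E] [NormedSpace ℝ E]
variable {M : Type*} [TopologicalSpace M] [ChartedSpace E M] [IsManifold 𝓘(ℝ, E) ∞ M]

/-! ### Vector fields in the preferred chart -/

/-! Everything is read in the preferred charts at x and y. A jet j¹_x b becomes a triple (C, A, B):
C = `valueMap` is b(x), A = `derivMap` is the differential of f, and B = `secondOrder` is the
differential of the matrix of b(z). It sends (v, a, c) in T²_x M to (Cv, Aa, B(a)v + Cc).
Semi-holonomic means C = A; conjugation by κ then only exchanges the arguments of B, so π(j·𝒳,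
κ(j)·𝒳) = B(a)v - B(v)a with v = p(𝒳), a = p_*(𝒳).

Write ∇_X Y = dY(X) + Γ(Y, X) at x, with Γ' in place of Γ at y; then T(X, Y) = Γ(Y, X) - Γ(X, Y). If
Z = bY, differentiating Z(f(z)) = b(z)Y(z) gives dZ(AX) = B(X)Y + C dY(X)
(`IsImage.fderiv_localRep`). Hence a semi-holonomic jet is affine exactly when B(X)Y = CΓ(Y, X) -
Γ'(CY, CX) (`isAffine_jet_iff`). So C determines B, and a bisection with this B exists
(`exists_localBisection`): the affine extension exists and is unique. Antisymmetrizing the formula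
for B gives the torsion defect.

A semi-holonomic jet is holonomic iff B is symmetric: necessity is the symmetry of second
derivatives, and for sufficiency f is taken to be the quadratic polynomial with coefficients C and
B/2.

For a symmetry jet C = A = -id, so Y + Z vanishes at x and [X, Y + Z] = d(Y + Z)(X) = 2 dY(X) -
B(X)Y there. Therefore Γ(Y, X) = -B(X)Y/2, and the torsion is half of an antisymmetrization of B. -/

/-- The components of the vector field `Y` in the preferred chart at `x`, as a map on the model
space. -/
def localRep (Y : ∀ z : M, TangentSpace 𝓘(ℝ, E) z) (x : M) (u : E) : E :=
  (trivializationAt E (TangentSpace 𝓘(ℝ, E)) x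
    (⟨(extChartAt 𝓘(ℝ, E) x).symm u, Y ((extChartAt 𝓘(ℝ, E) x).symm u)⟩ :
      TangentBundle 𝓘(ℝ, E) M)).2

section localRep

variable {x : M} {Y Z : ∀ z : M, TangentSpace 𝓘(ℝ, E) z}

theorem localRep_self : localRep Y x (extChartAt 𝓘(ℝ, E) x x) = (show E from Y x) := by
  unfold localRep
  rw [extChartAt_to_inv]
  exact trivializationAt_self x (Y x)

theorem localRep_eq_continuousLinearMapAt {u : E} (hu : u ∈ (extChartAt 𝓘(ℝ, E) x).target) :
    localRep Y x u = (trivializationAt E (TangentSpace 𝓘(ℝ, E)) x).continuousLinearMapAt ℝ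
      ((extChartAt 𝓘(ℝ, E) x).symm u) (Y ((extChartAt 𝓘(ℝ, E) x).symm u)) := by
  have h : (extChartAt 𝓘(ℝ, E) x).symm u ∈ (chartAt E x).source := by
    have := (extChartAt 𝓘(ℝ, E) x).map_target hu
    rwa [extChartAt_source] at this
  rw [Trivialization.continuousLinearMapAt_apply, Trivialization.linearMapAt_apply]
  exact (if_pos h).symm

omit [IsManifold 𝓘(ℝ, E) ∞ M] in
theorem eventually_mem_extChartAt_target (x : M) :
    ∀ᶠ u in 𝓝 (extChartAt 𝓘(ℝ, E) x x), u ∈ (extChartAt 𝓘(ℝ, E) x).target :=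
  extChartAt_target_mem_nhds (I := 𝓘(ℝ, E)) x

omit [IsManifold 𝓘(ℝ, E) ∞ M] in
theorem tendsto_extChartAt_symm (x : M) : Filter.Tendsto (extChartAt 𝓘(ℝ, E) x).symm
    (𝓝 (extChartAt 𝓘(ℝ, E) x x)) (𝓝 x) := by
  have := (continuousAt_extChartAt_symm (I := 𝓘(ℝ, E)) x).tendsto
  rwa [extChartAt_to_inv] at this

theorem localRep_add : localRep (fun z => Y z + Z z) x
    =ᶠ[𝓝 (extChartAt 𝓘(ℝ, E) x x)] localRep Y x + localRep Z x := by
  filter_upwards [eventually_mem_extChartAt_target x] with u hu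
  rw [Pi.add_apply, localRep_eq_continuousLinearMapAt hu, localRep_eq_continuousLinearMapAt hu,
    localRep_eq_continuousLinearMapAt hu, map_add]

theorem localRep_smul (g : M → ℝ) : localRep (fun z => g z • Y z) x
    =ᶠ[𝓝 (extChartAt 𝓘(ℝ, E) x x)]
      fun u => g ((extChartAt 𝓘(ℝ, E) x).symm u) • localRep Y x u := by
  filter_upwards [eventually_mem_extChartAt_target x] with u hu
  rw [localRep_eq_continuousLinearMapAt hu, localRep_eq_continuousLinearMapAt hu, map_smul]

theorem mdifferentiableAt_iff_comp_symm {F : Type*} [NormedAddCommGroup F] [NormedSpace ℝ F]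
    {h : M → F} :
    MDifferentiableAt 𝓘(ℝ, E) 𝓘(ℝ, F) h x ↔
      DifferentiableAt ℝ (fun u => h ((extChartAt 𝓘(ℝ, E) x).symm u))
        (extChartAt 𝓘(ℝ, E) x x) := by
  constructor
  · intro hh
    have := hh.differentiableWithinAt_writtenInExtChartAt
    simp only [modelWithCornersSelf_coe, Set.range_id] at this
    exact differentiableWithinAt_univ.1 this
  · intro hd
    have h1 : MDifferentiableAt 𝓘(ℝ, E) 𝓘(ℝ, E) (extChartAt 𝓘(ℝ, E) x) x :=
      mdifferentiableAt_extChartAt (mem_chart_source E x)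
    refine (MDifferentiableAt.comp (I' := 𝓘(ℝ, E))
      (g := fun u => h ((extChartAt 𝓘(ℝ, E) x).symm u)) x
      hd.mdifferentiableAt h1).congr_of_eventuallyEq ?_
    filter_upwards [extChartAt_source_mem_nhds (I := 𝓘(ℝ, E)) x] with z hz
    exact congrArg h ((extChartAt 𝓘(ℝ, E) x).left_inv hz).symm

theorem differentiableAt_localRep_iff :
    DifferentiableAt ℝ (localRep Y x) (extChartAt 𝓘(ℝ, E) x x) ↔
      MDifferentiableAt 𝓘(ℝ, E) 𝓘(ℝ, E).tangent
        (fun z => (⟨z, Y z⟩ : TangentBundle 𝓘(ℝ, E) M)) x :=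
  mdifferentiableAt_iff_comp_symm.symm.trans (mdifferentiableAt_section 𝓘(ℝ, E) Y).symm

/-- The bracket on M is computed by pulling the fields back along the inverse chart. Since the
trivialization at x is the derivative of the chart, the pulled-back fields are the `localRep`s near
the base point. -/
theorem mlieBracket_eq_fderiv_localRep :
    VectorField.mlieBracket 𝓘(ℝ, E) Y Z x =
      (fderiv ℝ (localRep Z x) (extChartAt 𝓘(ℝ, E) x x) (Y x) -
        fderiv ℝ (localRep Y x) (extChartAt 𝓘(ℝ, E) x x) (Z x) : E) := by
  have key : ∀ V : ∀ z : M, TangentSpace 𝓘(ℝ, E) z,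
      VectorField.mpullbackWithin 𝓘(ℝ, E) 𝓘(ℝ, E) (extChartAt 𝓘(ℝ, E) x).symm V
        (Set.range 𝓘(ℝ, E)) =ᶠ[𝓝 (extChartAt 𝓘(ℝ, E) x x)] localRep V x := by
    intro V
    filter_upwards [eventually_mem_extChartAt_target x] with u hu
    rw [localRep_eq_continuousLinearMapAt hu]
    have hs : (extChartAt 𝓘(ℝ, E) x).symm u ∈ (chartAt E x).source := by
      have := (extChartAt 𝓘(ℝ, E) x).map_target hu
      rwa [extChartAt_source] at this
    rw [TangentBundle.continuousLinearMapAt_trivializationAt hs,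
      VectorField.mpullbackWithin_apply]
    have h1 := mfderiv_extChartAt_comp_mfderivWithin_extChartAt_symm (I := 𝓘(ℝ, E)) hu
    have h2 := mfderivWithin_extChartAt_symm_comp_mfderiv_extChartAt' (I := 𝓘(ℝ, E))
      ((extChartAt 𝓘(ℝ, E) x).map_target hu)
    rw [(extChartAt 𝓘(ℝ, E) x).right_inv hu] at h2
    rw [ContinuousLinearMap.inverse_eq h2 h1]
    rfl
  -- Returning to M costs the inverse of the derivative at x of the preferred chart at x, which is
  -- the identity.
  have hinv : ∀ (L : E →L[ℝ] E) (v : E), L = ContinuousLinearMap.id ℝ E → L.inverse v = v := by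
    rintro L v rfl
    rw [ContinuousLinearMap.inverse_id, ContinuousLinearMap.id_apply]
  have hm := (VectorField.mlieBracketWithin_apply (I := 𝓘(ℝ, E)) (V := Y) (W := Z)
    (s := Set.univ) (x₀ := x)).trans (hinv _ _ mfderiv_extChartAt_self)
  refine hm.trans ?_
  have hl : ∀ (V W V' W' : E → E) (s : Set E) (u : E), s = Set.univ → V =ᶠ[𝓝 u] V' →
      W =ᶠ[𝓝 u] W' → VectorField.lieBracketWithin ℝ V W s u =
        fderiv ℝ W' u (V' u) - fderiv ℝ V' u (W' u) := by
    rintro V W V' W' s u rfl hV hW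
    rw [VectorField.lieBracketWithin_univ, hV.lieBracket_vectorField_eq hW,
      VectorField.lieBracket_eq]
  refine (hl _ _ _ _ _ _ (by simp) (key Y) (key Z)).trans ?_
  rw [localRep_self, localRep_self]

end localRep

/-! ### Christoffel symbols -/

section Christoffel

/-- `Γ` is the bilinear map formed by the Christoffel symbols of `D` at `x` in the preferred chart
at `x`: `∇_X Y = dY(X) + Γ(Y, X)`. -/
def IsChristoffel (D : Connection E M) (x : M) (Γ : E →L[ℝ] E →L[ℝ] E) : Prop :=
  ∀ Y : ∀ z : M, TangentSpace 𝓘(ℝ, E) z,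
    MDifferentiableAt 𝓘(ℝ, E) 𝓘(ℝ, E).tangent
      (fun z => (⟨z, Y z⟩ : TangentBundle 𝓘(ℝ, E) M)) x →
    ∀ X : TangentSpace 𝓘(ℝ, E) x,
      D Y x X = (fderiv ℝ (localRep Y x) (extChartAt 𝓘(ℝ, E) x x) X + Γ (Y x) X : E)

variable [FiniteDimensional ℝ E]

/-- The covariant derivative and the chart derivative obey the same Leibniz rule, so their
difference `Φ` is tensorial and depends only on Y(x), linearly; finite dimension makes it
continuous. -/
theorem exists_isChristoffel (D : Connection E M) (x : M) :
    ∃ Γ : E →L[ℝ] E →L[ℝ] E, IsChristoffel D x Γ := by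
  let Φ : (∀ z : M, TangentSpace 𝓘(ℝ, E) z) → (E →L[ℝ] E) := fun Y =>
    id (α := E →L[ℝ] E) (D Y x) - fderiv ℝ (localRep Y x) (extChartAt 𝓘(ℝ, E) x x)
  have hΦ : TensorialAt 𝓘(ℝ, E) E Φ x := by
    constructor
    · intro f σ hf hσ
      have h1 := D.isCovariantDerivativeOnUniv.leibniz hσ hf
      have hf' := (mdifferentiableAt_iff_comp_symm (h := f)).1 hf
      have hσ' := differentiableAt_localRep_iff.2 hσ
      have h2 := (localRep_smul (Y := σ) (x := x) f).fderiv_eq (𝕜 := ℝ)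
      have h3 := fderiv_fun_smul hf' hσ'
      -- The two Leibniz terms contain df on M and the derivative of f in the chart; these must
      -- agree for the terms to cancel.
      have h4 : (mfderiv 𝓘(ℝ, E) 𝓘(ℝ, ℝ) f x : E →L[ℝ] ℝ) =
          fderiv ℝ (fun u => f ((extChartAt 𝓘(ℝ, E) x).symm u)) (extChartAt 𝓘(ℝ, E) x x) := by
        rw [hf.mfderiv]
        simp only [modelWithCornersSelf_coe, Set.range_id]
        exact congrFun (fderivWithin_univ (𝕜 := ℝ)
          (f := fun u : E => f ((extChartAt 𝓘(ℝ, E) x).symm u))) _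
      rw [localRep_self, extChartAt_to_inv, ← h4] at h3
      have h5 : ∀ (A B : E →L[ℝ] E) (c : ℝ) (ℓ : E →L[ℝ] ℝ) (w : E),
          (c • A + ℓ.smulRight w) - (c • B + ℓ.smulRight w) = c • (A - B) := by
        intros; module
      exact (congrArg₂ (fun A B : E →L[ℝ] E => A - B) h1 (h2.trans h3)).trans (h5 _ _ _ _ _)
    · intro σ σ' hσ hσ'
      have h1 := D.isCovariantDerivativeOnUniv.add hσ hσ'
      have h2 := (localRep_add (Y := σ) (Z := σ') (x := x)).fderiv_eq (𝕜 := ℝ)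
      rw [fderiv_add (differentiableAt_localRep_iff.2 hσ) (differentiableAt_localRep_iff.2 hσ')]
        at h2
      exact (congrArg₂ (fun A B : E →L[ℝ] E => A - B) h1 h2).trans (add_sub_add_comm _ _ _ _)
  refine ⟨TensorialAt.mkHom Φ x hΦ, fun Y hY X => ?_⟩
  have h := congrArg (fun L : E →L[ℝ] E => L X) (TensorialAt.mkHom_apply hΦ hY)
  exact ((congrArg (fun w : E => (fderiv ℝ (localRep Y x) (extChartAt 𝓘(ℝ, E) x x) X : E) + w) h).trans
    (add_sub_cancel _ _)).symm

/-- Evaluated on extensions of X and Y, the derivative terms cancel against the bracket. -/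
theorem IsChristoffel.torsion_eq {D : Connection E M} {x : M} {Γ : E →L[ℝ] E →L[ℝ] E}
    (hΓ : IsChristoffel D x Γ) (X Y : TangentSpace 𝓘(ℝ, E) x) :
    D.torsion x X Y = (Γ Y X - Γ X Y : E) := by
  have hX := FiberBundle.mdifferentiableAt_extend 𝓘(ℝ, E) E X
  have hY := FiberBundle.mdifferentiableAt_extend 𝓘(ℝ, E) E Y
  have h := CovariantDerivative.torsion_apply D hX hY
  rw [mlieBracket_eq_fderiv_localRep, hΓ _ hX, hΓ _ hY] at h
  simp only [FiberBundle.extend_apply_self] at h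
  refine h.trans ?_
  generalize fderiv ℝ (localRep (FiberBundle.extend E X) x) (extChartAt 𝓘(ℝ, E) x x) = A
  generalize fderiv ℝ (localRep (FiberBundle.extend E Y) x) (extChartAt 𝓘(ℝ, E) x x) = B
  have : ∀ A B : E →L[ℝ] E, ∀ X Y a b : E, (B X + a) - (A Y + b) - (B X - A Y) = a - b := by
    intros; abel
  exact this A B X Y _ _

end Christoffel

/-! ### Local bisections in coordinates -/

namespace LocalBisection

variable {x y : M} (b : LocalBisection E x y)

/-- The differential of the matrix of `b(z)` in coordinates around `x` and around `y`. -/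
def secondOrder : E →L[ℝ] E →L[ℝ] E := b.taylor.2.2

/-- The value of `b` at `x`, as an endomorphism of the model space. -/
def valueMap : E →L[ℝ] E :=
  (b.value : TangentSpace 𝓘(ℝ, E) x →L[ℝ] TangentSpace 𝓘(ℝ, E) y)

/-- The differential at `x` of the map underlying `b`, as an endomorphism of the model space. -/
def derivMap : E →L[ℝ] E := b.deriv

/-- The expression in coordinates around `x` and around `y` of the map underlying `b`. -/
def baseRep (u : E) : E :=
  extChartAt 𝓘(ℝ, E) y (b.base ((extChartAt 𝓘(ℝ, E) x).symm u))

/-- The matrix of `b(z)` in coordinates around `x` and around `y`. -/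
def matrixRep (u : E) : E →L[ℝ] E := coords b.toFun x ((extChartAt 𝓘(ℝ, E) x).symm u)

theorem hasFDerivAt_baseRep :
    HasFDerivAt b.baseRep b.derivMap (extChartAt 𝓘(ℝ, E) x x) := by
  have hb : MDifferentiableAt 𝓘(ℝ, E) 𝓘(ℝ, E) b.base x :=
    b.isLocalDiffeomorphAt.mdifferentiableAt (by simp)
  have h := hb.hasMFDerivAt.2
  simp only [modelWithCornersSelf_coe, Set.range_id] at h
  have h' := HasFDerivWithinAt.hasFDerivAt_of_univ h
  have e : writtenInExtChartAt 𝓘(ℝ, E) 𝓘(ℝ, E) x b.base = b.baseRep := by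
    funext u
    simp only [writtenInExtChartAt, baseRep, Function.comp_apply]
    rw [b.base_self]
  rw [← e]
  exact h'

theorem hasFDerivAt_matrixRep :
    HasFDerivAt b.matrixRep b.secondOrder (extChartAt 𝓘(ℝ, E) x x) := by
  have hc : MDifferentiableAt 𝓘(ℝ, E) 𝓘(ℝ, E →L[ℝ] E) (coords b.toFun x) x :=
    b.smooth.self_of_nhds.mdifferentiableAt (by simp)
  have h := hc.hasMFDerivAt.2
  simp only [modelWithCornersSelf_coe, Set.range_id] at h
  exact HasFDerivWithinAt.hasFDerivAt_of_univ h

theorem matrixRep_self (v : E) :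
    b.matrixRep (extChartAt 𝓘(ℝ, E) x x) v = b.valueMap v := by
  unfold matrixRep
  rw [extChartAt_to_inv]
  exact b.coords_self v

/-- Lets the matrix of b(z), which `coords` builds with the chart at f(x), be used with the chart at
y = f(x). -/
theorem trivializationAt_actTM (V : TangentBundle 𝓘(ℝ, E) M)
    (h₁ : V.proj ∈ (chartAt E x).source) (h₂ : b.base V.proj ∈ (chartAt E y).source) :
    (trivializationAt E (TangentSpace 𝓘(ℝ, E)) y (b.actTM V)).2 =
      coords b.toFun x V.proj (trivializationAt E (TangentSpace 𝓘(ℝ, E)) x V).2 := by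
  have hy : (b.toFun x).1 = y := b.base_self
  simp only [coords, inTangentCoordinates, ContinuousLinearMap.inCoordinates]
  rw [ContinuousLinearMap.comp_apply, ContinuousLinearMap.comp_apply,
    Trivialization.symmL_apply _ h₁, Trivialization.continuousLinearMapAt_apply,
    Trivialization.linearMapAt_apply]
  have h₃ : (b.toFun V.proj).1 ∈
      (trivializationAt E (TangentSpace 𝓘(ℝ, E)) (b.toFun x).1).baseSet := by
    rw [hy]
    exact h₂
  rw [if_pos h₃]
  simp only [hy]
  have := (trivializationAt E (TangentSpace 𝓘(ℝ, E)) x).symm_apply_apply_mk h₁ V.snd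
  exact congrArg (fun w => (trivializationAt E (TangentSpace 𝓘(ℝ, E)) y
    (b.actTM ⟨V.proj, w⟩)).2) this.symm

theorem tendsto_base : Filter.Tendsto b.base (𝓝 x) (𝓝 y) := by
  have h : ContinuousAt b.base x := b.isLocalDiffeomorphAt.contMDiffAt.continuousAt
  have := h.tendsto
  rwa [b.base_self] at this

theorem eventually_mem_source :
    ∀ᶠ z in 𝓝 x, z ∈ (chartAt E x).source ∧ b.base z ∈ (chartAt E y).source :=
  Filter.Eventually.and (chart_source_mem_nhds E x) (b.tendsto_base.eventually (chart_source_mem_nhds E y))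

theorem exists_inverse : ∃ g : M → M, MDifferentiableAt 𝓘(ℝ, E) 𝓘(ℝ, E) g y ∧ g y = x ∧
    (∀ᶠ z in 𝓝 x, g (b.base z) = z) ∧ ∀ᶠ w in 𝓝 y, b.base (g w) = w := by
  have h : IsLocalDiffeomorphAt 𝓘(ℝ, E) 𝓘(ℝ, E) ∞ b.base x := b.isLocalDiffeomorphAt
  have hl := h.localInverse_eventuallyEq_left
  have hr := h.localInverse_eventuallyEq_right
  have hd := h.localInverse_mdifferentiableAt (by simp)
  have hx := hl.self_of_nhds
  simp only [b.base_self, Function.comp_apply] at hr hd hx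
  exact ⟨h.localInverse, hd, hx, hl, hr⟩

/-! ### Images of vector fields under a bisection -/

section IsImage

variable {b} {Y Z : ∀ z : M, TangentSpace 𝓘(ℝ, E) z}

theorem exists_isImage (b : LocalBisection E x y) (Y : ∀ z : M, TangentSpace 𝓘(ℝ, E) z) :
    ∃ Z : ∀ z : M, TangentSpace 𝓘(ℝ, E) z, b.IsImage Y Z := by
  obtain ⟨g, -, -, hg, -⟩ := b.exists_inverse
  -- The value lies in the tangent space at f(g(w)), which is w only for w near y; elsewhere it is
  -- an arbitrary vector of `E`.
  refine ⟨fun w => ((b.toFun (g w)).2 (Y (g w)) : E), ?_⟩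
  filter_upwards [hg] with z hz
  exact congrArg (fun z => ((b.toFun z).2 (Y z) : E)) hz

theorem IsImage.apply_self (h : b.IsImage Y Z) : Z y = b.value (Y x) := by
  have h1 : (⟨b.base x, Z (b.base x)⟩ : TangentBundle 𝓘(ℝ, E) M) = b.actTM ⟨x, Y x⟩ :=
    congrArg (fun w => (⟨b.base x, w⟩ : TangentBundle 𝓘(ℝ, E) M)) h.self_of_nhds
  rw [b.actTM_self, b.base_self] at h1
  exact TotalSpace.mk_inj.1 h1

theorem IsImage.localRep_eq (h : b.IsImage Y Z) :
    ∀ᶠ z in 𝓝 x, localRep Z y (extChartAt 𝓘(ℝ, E) y (b.base z)) =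
      b.matrixRep (extChartAt 𝓘(ℝ, E) x z) (localRep Y x (extChartAt 𝓘(ℝ, E) x z)) := by
  filter_upwards [h, b.eventually_mem_source] with z hz hm
  have h₁ := hm.1
  have h₂ := hm.2
  rw [← extChartAt_source 𝓘(ℝ, E)] at h₁ h₂
  unfold localRep matrixRep
  rw [(extChartAt 𝓘(ℝ, E) x).left_inv h₁, (extChartAt 𝓘(ℝ, E) y).left_inv h₂, hz]
  exact b.trivializationAt_actTM ⟨z, Y z⟩ hm.1 hm.2

theorem hasFDerivAt_matrixRep_localRep (b : LocalBisection E x y)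
    (hY : MDifferentiableAt 𝓘(ℝ, E) 𝓘(ℝ, E).tangent
      (fun z => (⟨z, Y z⟩ : TangentBundle 𝓘(ℝ, E) M)) x) :
    HasFDerivAt (fun u => b.matrixRep u (localRep Y x u))
      (b.secondOrder.flip (Y x) +
        b.valueMap.comp (fderiv ℝ (localRep Y x) (extChartAt 𝓘(ℝ, E) x x))) (extChartAt 𝓘(ℝ, E) x x) := by
  refine (b.hasFDerivAt_matrixRep.clm_apply
    (differentiableAt_localRep_iff.2 hY).hasFDerivAt).congr_fderiv ?_
  ext v
  rw [localRep_self]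
  simp only [add_apply, ContinuousLinearMap.comp_apply, b.matrixRep_self]
  exact add_comm _ _

/-- Near y the field Z is, in coordinates, the matrix of b applied to Y, composed with the local
inverse of f. -/
theorem IsImage.mdifferentiableAt (h : b.IsImage Y Z)
    (hY : MDifferentiableAt 𝓘(ℝ, E) 𝓘(ℝ, E).tangent
      (fun z => (⟨z, Y z⟩ : TangentBundle 𝓘(ℝ, E) M)) x) :
    MDifferentiableAt 𝓘(ℝ, E) 𝓘(ℝ, E).tangent
      (fun z => (⟨z, Z z⟩ : TangentBundle 𝓘(ℝ, E) M)) y := by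
  obtain ⟨g, hd, hgy, -, hg⟩ := b.exists_inverse
  refine differentiableAt_localRep_iff.1 ?_
  have hg' : Filter.Tendsto g (𝓝 y) (𝓝 x) := by
    have := hd.continuousAt.tendsto
    rwa [hgy] at this
  have hφ : MDifferentiableAt 𝓘(ℝ, E) 𝓘(ℝ, E) (fun w => extChartAt 𝓘(ℝ, E) x (g w)) y := by
    refine MDifferentiableAt.comp (I' := 𝓘(ℝ, E)) (g := extChartAt 𝓘(ℝ, E) x) y ?_ hd
    rw [hgy]
    exact mdifferentiableAt_extChartAt (mem_chart_source E x)
  have hφ' := (mdifferentiableAt_iff_comp_symm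
    (h := fun w => extChartAt 𝓘(ℝ, E) x (g w))).1 hφ
  have hH := (b.hasFDerivAt_matrixRep_localRep hY).differentiableAt
  have hval : extChartAt 𝓘(ℝ, E) x (g ((extChartAt 𝓘(ℝ, E) y).symm (extChartAt 𝓘(ℝ, E) y y))) =
      extChartAt 𝓘(ℝ, E) x x := by
    rw [extChartAt_to_inv, hgy]
  rw [← hval] at hH
  refine (DifferentiableAt.comp (extChartAt 𝓘(ℝ, E) y y)
    (f := fun u => extChartAt 𝓘(ℝ, E) x (g ((extChartAt 𝓘(ℝ, E) y).symm u))) hH hφ').congr_of_eventuallyEq ?_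
  have hs := tendsto_extChartAt_symm (E := E) y
  filter_upwards [hs.eventually hg, (hg'.comp hs).eventually h.localRep_eq,
    eventually_mem_extChartAt_target y] with u h1 h2 h3
  simp only [Function.comp_apply] at h2 ⊢
  rw [← h2, h1, (extChartAt 𝓘(ℝ, E) y).right_inv h3]

/-- Chain rule on the left and product rule on the right of Z(f(z)) = b(z)Y(z). This is how B enters
both the affine condition and the connection of a symmetry jet. -/
theorem IsImage.fderiv_localRep (h : b.IsImage Y Z)
    (hY : MDifferentiableAt 𝓘(ℝ, E) 𝓘(ℝ, E).tangent
      (fun z => (⟨z, Y z⟩ : TangentBundle 𝓘(ℝ, E) M)) x) (X : E) :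
    fderiv ℝ (localRep Z y) (extChartAt 𝓘(ℝ, E) y y) (b.derivMap X) =
      b.secondOrder X (Y x) +
        b.valueMap (fderiv ℝ (localRep Y x) (extChartAt 𝓘(ℝ, E) x x) X) := by
  have hZ := (differentiableAt_localRep_iff.2 (h.mdifferentiableAt hY)).hasFDerivAt
  have hval : b.baseRep (extChartAt 𝓘(ℝ, E) x x) = extChartAt 𝓘(ℝ, E) y y := by
    unfold baseRep
    rw [extChartAt_to_inv, b.base_self]
  rw [← hval] at hZ
  have h1 := hZ.comp _ b.hasFDerivAt_baseRep
  have hs := tendsto_extChartAt_symm (E := E) x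
  have he : (localRep Z y ∘ b.baseRep) =ᶠ[𝓝 (extChartAt 𝓘(ℝ, E) x x)]
      fun u => b.matrixRep u (localRep Y x u) := by
    filter_upwards [hs.eventually h.localRep_eq, eventually_mem_extChartAt_target x] with u h2 h3
    rw [(extChartAt 𝓘(ℝ, E) x).right_inv h3] at h2
    exact h2
  have h2 := h1.unique ((b.hasFDerivAt_matrixRep_localRep hY).congr_of_eventuallyEq he)
  rw [hval] at h2
  exact congrArg (fun L : E →L[ℝ] E => L X) h2

end IsImage

theorem jet_eq_iff {b b' : LocalBisection E x y} : b.jet = b'.jet ↔ b.taylor = b'.taylor :=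
  Quotient.eq

end LocalBisection

/-! ### The second tangent bundle in induced coordinates -/

namespace T2

variable {x : M}

/-- The element of `T²_x M` with coordinates `(x, v, a, c)` in the induced coordinates. -/
def ofCoords (x : M) (v a c : E) : T2 E x :=
  ⟨v, ((a, c) : E × E)⟩

theorem exists_eq_ofCoords (𝒳 : T2 E x) : ∃ v a c : E, 𝒳 = ofCoords x v a c :=
  ⟨𝒳.1, Prod.fst (α := E) (β := E) 𝒳.2, Prod.snd (α := E) (β := E) 𝒳.2, rfl⟩

theorem p_ofCoords (v a c : E) : (ofCoords x v a c).p = v := rfl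

theorem pStar_eq (𝒳 : T2 E x) : 𝒳.pStar = Prod.fst (α := E) (β := E) 𝒳.2 := by
  have h : HasMFDerivAt 𝓘(ℝ, E).tangent 𝓘(ℝ, E)
      (fun q : TangentBundle 𝓘(ℝ, E) M => q.proj) ⟨x, 𝒳.1⟩ (ContinuousLinearMap.fst ℝ E E) := by
    refine ⟨(FiberBundle.continuous_proj E (TangentSpace 𝓘(ℝ, E))).continuousAt, ?_⟩
    refine HasFDerivAt.hasFDerivWithinAt ?_
    refine (hasFDerivAt_fst (𝕜 := ℝ) (E := E) (F := E)).congr_of_eventuallyEq ?_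
    have h1 : ∀ᶠ q : E × E in 𝓝 (extChartAt 𝓘(ℝ, E).tangent (⟨x, 𝒳.1⟩ : TangentBundle 𝓘(ℝ, E) M)
        ⟨x, 𝒳.1⟩), q.1 ∈ (extChartAt 𝓘(ℝ, E) x).target := by
      refine (continuousAt_fst (X := E) (Y := E)).eventually ?_
      exact eventually_mem_extChartAt_target x
    filter_upwards [h1] with q hq
    have := congrArg (fun z : TangentBundle 𝓘(ℝ, E) M => extChartAt 𝓘(ℝ, E) x z.proj)
      (extChartAt_tangent_symm (⟨x, 𝒳.1⟩ : TangentBundle 𝓘(ℝ, E) M) q hq)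
    exact this.trans ((extChartAt 𝓘(ℝ, E) x).right_inv hq)
  unfold pStar
  rw [h.mfderiv]
  rfl

theorem pStar_ofCoords (v a c : E) : (ofCoords x v a c).pStar = a :=
  pStar_eq _

theorem translate_ofCoords (v a c V : E) :
    translate (ofCoords x v a c) V = ofCoords x v a (c + V) := by
  have h := verticalLift_eq (x := x) v V
  have h' : ((a, c) : E × E) + (0, V) = (a, c + V) := by simp
  exact congrArg (fun w : E × E => (⟨v, w⟩ : T2 E x))
    ((congrArg (fun w : E × E => ((a, c) : E × E) + w) h).trans h')

theorem diff_ofCoords (v a c d : E) :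
    diff (ofCoords x v a c) (ofCoords x v a d) = (c - d : E) := by
  have h := translate_ofCoords (x := x) v a d (c - d)
  rw [add_sub_cancel] at h
  exact (congrArg (fun 𝒵 => diff 𝒵 (ofCoords x v a d)) h).symm.trans (diff_translate _ _)

end T2

/-- The action on TM is (u, w) ↦ (f(u), C(u)w) in coordinates; this is its derivative at (x, v) in
the direction (a, c). -/
theorem LocalBisection.actT2_ofCoords {x y : M} (b : LocalBisection E x y) (v a c : E) :
    b.actT2 (T2.ofCoords x v a c) =
      T2.ofCoords y (b.valueMap v) (b.derivMap a) (b.secondOrder a v + b.valueMap c) := by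
  unfold LocalBisection.actT2
  have h := (b.hasMFDerivAt_actTM v).mfderiv
  exact congrArg (fun L : E × E →L[ℝ] E × E => (⟨b.valueMap v, L (a, c)⟩ : T2 E y)) h

/-! ### The second order part of affine jets and of symmetry jets -/

namespace LocalBisection

variable {x y : M} {b : LocalBisection E x y}

theorem isSemiholonomic_jet_iff : b.jet.IsSemiholonomic ↔ b.valueMap = b.derivMap :=
  Iff.rfl

theorem act_jet (v a c : E) : b.jet.act (T2.ofCoords x v a c) =
    T2.ofCoords y (b.valueMap v) (b.derivMap a) (b.secondOrder a v + b.valueMap c) :=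
  b.actT2_ofCoords v a c

/-- The two flips exchange the inputs v, a and then the outputs, so the roles of C and A and the
arguments of B are interchanged. -/
theorem kappaAct_jet (v a c : E) : b.jet.kappaAct (T2.ofCoords x v a c) =
    T2.ofCoords y (b.derivMap v) (b.valueMap a) (b.secondOrder v a + b.valueMap c) :=
  congrArg T2.kappa (b.act_jet a v c)

theorem sameFiber_act_kappaAct (hb : b.jet.IsSemiholonomic) (𝒳 : T2 E x) :
    T2.SameFiber (b.jet.act 𝒳) (b.jet.kappaAct 𝒳) := by
  obtain ⟨v, a, c, rfl⟩ := 𝒳.exists_eq_ofCoords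
  rw [isSemiholonomic_jet_iff] at hb
  rw [act_jet, kappaAct_jet, hb]
  exact ⟨rfl, (T2.pStar_ofCoords _ _ _).trans (T2.pStar_ofCoords _ _ _).symm⟩

/-- The common term Cc cancels, which leaves the antisymmetrization of B. -/
theorem diff_act_kappaAct (hb : b.jet.IsSemiholonomic) (𝒳 : T2 E x) :
    T2.diff (b.jet.act 𝒳) (b.jet.kappaAct 𝒳) =
      (b.secondOrder 𝒳.pStar 𝒳.p - b.secondOrder 𝒳.p 𝒳.pStar : E) := by
  obtain ⟨v, a, c, rfl⟩ := 𝒳.exists_eq_ofCoords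
  rw [isSemiholonomic_jet_iff] at hb
  rw [act_jet, kappaAct_jet, hb, T2.diff_ofCoords, T2.pStar_ofCoords, T2.p_ofCoords]
  exact add_sub_add_right_eq_sub _ _ _

theorem diff_kappaAct_act (hb : b.jet.IsSemiholonomic) (𝒳 : T2 E x) :
    T2.diff (b.jet.kappaAct 𝒳) (b.jet.act 𝒳) =
      (b.secondOrder 𝒳.p 𝒳.pStar - b.secondOrder 𝒳.pStar 𝒳.p : E) := by
  obtain ⟨v, a, c, rfl⟩ := 𝒳.exists_eq_ofCoords
  rw [isSemiholonomic_jet_iff] at hb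
  rw [act_jet, kappaAct_jet, hb, T2.diff_ofCoords, T2.pStar_ofCoords, T2.p_ofCoords]
  exact add_sub_add_right_eq_sub _ _ _

end LocalBisection

theorem Jet11.exists_rep {x y : M} (j : Jet11 E x y) : ∃ b : LocalBisection E x y, b.jet = j :=
  Quotient.exists_rep j

theorem SmoothNear.mdifferentiableAt {x : M} {Y : ∀ z : M, TangentSpace 𝓘(ℝ, E) z}
    (hY : SmoothNear Y x) : MDifferentiableAt 𝓘(ℝ, E) 𝓘(ℝ, E).tangent
      (fun z => (⟨z, Y z⟩ : TangentBundle 𝓘(ℝ, E) M)) x :=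
  hY.self_of_nhds.mdifferentiableAt (by simp)

theorem exists_smoothNear {x : M} (v : TangentSpace 𝓘(ℝ, E) x) :
    ∃ Y : ∀ z : M, TangentSpace 𝓘(ℝ, E) z, SmoothNear Y x ∧ Y x = v := by
  refine ⟨FiberBundle.extend E v, ?_, FiberBundle.extend_apply_self (F := E) v⟩
  obtain ⟨s, hs, h⟩ := FiberBundle.exists_contMDiffOn_extend (k := ∞) 𝓘(ℝ, E) E v
  filter_upwards [eventually_mem_nhds_iff.2 hs] with z hz
  exact h.contMDiffAt hz

/-- In b(∇_X Y) = ∇_{bX}(bY) the terms C dY(X) cancel. What remains involves Y only through Y(x), so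
it is a condition on the Taylor coefficients alone. -/
theorem isAffine_jet_iff {D : Connection E M} {x y : M} {Γ Γ' : E →L[ℝ] E →L[ℝ] E}
    (hΓ : IsChristoffel D x Γ) (hΓ' : IsChristoffel D y Γ') (b : LocalBisection E x y) :
    IsAffine D b.jet ↔ b.valueMap = b.derivMap ∧ ∀ X Y : E, b.secondOrder X Y =
      b.valueMap (Γ Y X) - Γ' (b.valueMap Y) (b.valueMap X) := by
  -- Stated for every bisection, because `IsAffine` supplies its own representative of the jet; it
  -- has the same Taylor coefficients.
  have key : ∀ (b : LocalBisection E x y), b.valueMap = b.derivMap →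
      ∀ Y Z : ∀ z : M, TangentSpace 𝓘(ℝ, E) z, SmoothNear Y x → b.IsImage Y Z →
      ∀ X : TangentSpace 𝓘(ℝ, E) x, b.value (D Y x X) = D Z y (b.value X) ↔
        b.secondOrder X (Y x) =
          b.valueMap (Γ (Y x) X) - Γ' (b.valueMap (Y x)) (b.valueMap X) := by
    intro b hb Y Z hY hZ X
    have h1 := hΓ Y hY.mdifferentiableAt X
    have h2 := hΓ' Z (hZ.mdifferentiableAt hY.mdifferentiableAt) (b.value X)
    have h3 := hZ.fderiv_localRep hY.mdifferentiableAt X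
    rw [← hb] at h3
    have h4 := hZ.apply_self
    rw [h1, h2, h4]
    have h5 : ∀ (C A : E →L[ℝ] E) (B d g g' : E), A (C X) = B + C d →
        (C (d + g) = A (C X) + g' ↔ B = C g - g') := by
      intro C A B d g g' h
      rw [h, map_add, eq_sub_iff_add_eq]
      constructor
      · intro h
        have : C d + C g = C d + (B + g') := by rw [h]; abel
        exact (add_left_cancel this).symm
      · intro h
        rw [← h]
        abel
    exact h5 b.valueMap _ _ _ _ _ h3
  constructor
  · rintro ⟨hs, b', hb', h⟩
    have hs' : b.valueMap = b.derivMap := hs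
    refine ⟨hs', fun X Y => ?_⟩
    have ht := LocalBisection.jet_eq_iff.1 hb'
    have e1 : b'.value = b.value := congrArg Prod.fst ht
    have e2 : b'.valueMap = b.valueMap := by
      unfold LocalBisection.valueMap
      rw [e1]
    have e3 : b'.derivMap = b.derivMap := congrArg (fun t => t.2.1) ht
    have e4 : b'.secondOrder = b.secondOrder := congrArg (fun t => t.2.2) ht
    obtain ⟨Y', hY', rfl⟩ := exists_smoothNear (x := x) Y
    obtain ⟨Z, hZ⟩ := LocalBisection.exists_isImage b' Y'
    rw [← e2, ← e4]
    refine (key b' (by rw [e2, e3, hs']) Y' Z hY' hZ X).1 ?_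
    rw [e1]
    exact h Y' Z hY' hZ X
  · rintro ⟨hs, h⟩
    exact ⟨hs, b, rfl, fun Y Z hY hZ X => (key b hs Y Z hY hZ X).2 (h X (Y x))⟩

theorem IsAffine.sameFiber_and_diff_eq [FiniteDimensional ℝ E] {D : Connection E M} {x y : M}
    {S : Jet11 E x y} (hS : IsAffine D S) (𝒳 : T2 E x) :
    T2.SameFiber (S.act 𝒳) (S.kappaAct 𝒳) ∧
      T2.diff (S.act 𝒳) (S.kappaAct 𝒳) =
        S.p (D.torsion x 𝒳.pStar 𝒳.p) - D.torsion y (S.p 𝒳.pStar) (S.p 𝒳.p) := by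
  obtain ⟨b, rfl⟩ := S.exists_rep
  obtain ⟨Γ, hΓ⟩ := exists_isChristoffel D x
  obtain ⟨Γ', hΓ'⟩ := exists_isChristoffel D y
  obtain ⟨-, h⟩ := (isAffine_jet_iff hΓ hΓ' b).1 hS
  refine ⟨b.sameFiber_act_kappaAct hS.1 𝒳, ?_⟩
  rw [b.diff_act_kappaAct hS.1, hΓ.torsion_eq, hΓ'.torsion_eq]
  have h1 : ∀ u v : E, b.secondOrder u v - b.secondOrder v u = b.valueMap (Γ v u - Γ u v) -
      (Γ' (b.valueMap v) (b.valueMap u) - Γ' (b.valueMap u) (b.valueMap v)) := by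
    intro u v
    rw [h, h, map_sub]
    abel
  exact h1 _ _

theorem SymmetryJet.Induces.sameFiber_and_torsion_eq [FiniteDimensional ℝ E] {D : Connection E M}
    {s : SymmetryJet E M} (hs : s.Induces D) (x : M) (𝒳 : T2 E x) :
    T2.SameFiber ((s.toFun x).kappaAct 𝒳) ((s.toFun x).act 𝒳) ∧
      D.torsion x 𝒳.pStar 𝒳.p =
        (1 / 2 : ℝ) • T2.diff ((s.toFun x).kappaAct 𝒳) ((s.toFun x).act 𝒳) := by
  obtain ⟨b, hb, h⟩ := hs x
  have hsh := s.isSemiholonomic x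
  have hp := s.p_apply x
  rw [← hb] at hsh hp ⊢
  refine ⟨(b.sameFiber_act_kappaAct hsh 𝒳).imp Eq.symm Eq.symm, ?_⟩
  obtain ⟨Γ, hΓ⟩ := exists_isChristoffel D x
  have hval : ∀ v : E, b.valueMap v = -v := hp
  have hder : ∀ v : E, b.derivMap v = -v := fun v =>
    (congrArg (fun L : E →L[ℝ] E => L v) hsh).symm.trans (hval v)
  -- Y + Z vanishes at x, so the bracket loses its term dX(Y + Z); with A = C = -id, dZ(X) = dY(X) -
  -- B(X)Y.
  have hB : ∀ X Y : E, Γ Y X = -((1 / 2 : ℝ) • b.secondOrder X Y) := by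
    intro X Y
    obtain ⟨X', hX', rfl⟩ := exists_smoothNear (x := x) X
    obtain ⟨Y', hY', rfl⟩ := exists_smoothNear (x := x) Y
    obtain ⟨Z, hZ⟩ := LocalBisection.exists_isImage b Y'
    have h1 := h X' Y' Z hX' hY' hZ
    have hZ' := hZ.mdifferentiableAt hY'.mdifferentiableAt
    have h2 := hZ.fderiv_localRep hY'.mdifferentiableAt (X' x : E)
    have h3 : Z x = -Y' x := hZ.apply_self.trans (hval _)
    rw [hΓ Y' hY'.mdifferentiableAt, mlieBracket_eq_fderiv_localRep, localRep_add.fderiv_eq,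
      fderiv_add (differentiableAt_localRep_iff.2 hY'.mdifferentiableAt)
        (differentiableAt_localRep_iff.2 hZ'), h3, add_neg_cancel] at h1
    have h4 : ∀ (A B C : E →L[ℝ] E) (u r g : E), B (b.derivMap u) = r + b.valueMap (A u) →
        A u + g = (1 / 2 : ℝ) • ((A + B) u - C 0) → g = -((1 / 2 : ℝ) • r) := by
      intro A B C u r g h h'
      rw [hval, hder, map_neg] at h
      rw [map_zero, sub_zero, add_apply] at h'
      have e1 : B u = A u - r := by rw [← neg_neg (B u), h]; abel
      rw [e1] at h'
      have e2 : g = (1 / 2 : ℝ) • (A u + (A u - r)) - A u := by rw [← h']; abel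
      rw [e2]
      module
    exact h4 _ _ _ _ _ _ h2 h1
  rw [hΓ.torsion_eq, b.diff_kappaAct_act hsh]
  have h5 : ∀ u v : E, Γ v u - Γ u v =
      (1 / 2 : ℝ) • (b.secondOrder v u - b.secondOrder u v) := by
    intro u v
    rw [hB, hB]
    module
  exact h5 _ _

/-! ### Construction of local bisections -/

theorem isOpen_setOf_isInvertible [CompleteSpace E] :
    IsOpen {L : E →L[ℝ] E | L.IsInvertible} :=
  ContinuousLinearEquiv.isOpen

/-- The inverse function theorem gives the local inverse. Its domain is shrunk to the open set where
dF is invertible, which makes the inverse smooth on the whole target and not only at F(a). -/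
theorem isLocalDiffeomorphAt_of_hasFDerivAt [CompleteSpace E] {F : E → E} {a : E}
    (hF : ContDiff ℝ ∞ F) (η : E ≃L[ℝ] E) (h : HasFDerivAt F (η : E →L[ℝ] E) a) :
    IsLocalDiffeomorphAt 𝓘(ℝ, E) 𝓘(ℝ, E) ∞ F a := by
  let e := hF.contDiffAt.toOpenPartialHomeomorph F h (by simp)
  have he : ∀ u, e u = F u := fun _ => rfl
  have hs : IsOpen {u | (fderiv ℝ F u).IsInvertible} :=
    isOpen_setOf_isInvertible.preimage (hF.continuous_fderiv (by simp))
  let e' := e.restrOpen _ hs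
  have hsource : ∀ {u}, u ∈ e'.source → (fderiv ℝ F u).IsInvertible := fun hu => hu.2
  refine ⟨⟨e'.toPartialEquiv, e'.open_source, e'.open_target, ?_, ?_⟩, ?_, fun _ _ => rfl⟩
  · exact hF.contMDiff.contMDiffOn
  · intro w hw
    obtain ⟨A, hA⟩ := hsource (e'.map_target hw)
    have h1 : HasFDerivAt e' (A : E →L[ℝ] E) (e'.symm w) := by
      rw [hA]
      exact (hF.differentiable (by simp) _).hasFDerivAt
    exact (e'.contDiffAt_symm hw h1 hF.contDiffAt).contMDiffAt.contMDiffWithinAt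
  · refine ⟨hF.contDiffAt.mem_toOpenPartialHomeomorph_source h (by simp), ?_⟩
    exact ⟨η, h.fderiv.symm⟩

/-- The preferred chart at `x` as a partial diffeomorphism. -/
def chartDiffeomorph (x : M) : PartialDiffeomorph 𝓘(ℝ, E) 𝓘(ℝ, E) M E ∞ where
  toPartialEquiv := extChartAt 𝓘(ℝ, E) x
  open_source := isOpen_extChartAt_source x
  open_target := isOpen_extChartAt_target x
  contMDiffOn_toFun := by
    rw [extChartAt_source]
    exact contMDiffOn_extChartAt
  contMDiffOn_invFun := contMDiffOn_extChartAt_symm x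

theorem isInvertible_continuousLinearMapAt {x z : M} (hz : z ∈ (chartAt E x).source) :
    ContinuousLinearMap.IsInvertible
      ((trivializationAt E (TangentSpace 𝓘(ℝ, E)) x).continuousLinearMapAt ℝ z) :=
  ⟨(trivializationAt E (TangentSpace 𝓘(ℝ, E)) x).continuousLinearEquivAt ℝ z hz,
    Trivialization.coe_continuousLinearEquivAt_eq' _ hz⟩

theorem isInvertible_symmL {x z : M} (hz : z ∈ (chartAt E x).source) :
    ContinuousLinearMap.IsInvertible
      ((trivializationAt E (TangentSpace 𝓘(ℝ, E)) x).symmL ℝ z) :=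
  ⟨((trivializationAt E (TangentSpace 𝓘(ℝ, E)) x).continuousLinearEquivAt ℝ z hz).symm,
    Trivialization.symm_continuousLinearEquivAt_eq' _ hz⟩

theorem continuousLinearMapAt_self (x : M) (v : TangentSpace 𝓘(ℝ, E) x) :
    (trivializationAt E (TangentSpace 𝓘(ℝ, E)) x).continuousLinearMapAt ℝ x v = (v : E) := by
  rw [Trivialization.continuousLinearMapAt_apply, Trivialization.linearMapAt_apply]
  exact (if_pos (mem_chart_source E x)).trans (trivializationAt_self x v)

theorem symmL_self (x : M) (v : E) :
    (trivializationAt E (TangentSpace 𝓘(ℝ, E)) x).symmL ℝ x v = (v : E) := by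
  have h := (trivializationAt E (TangentSpace 𝓘(ℝ, E)) x).continuousLinearMapAt_symmL (R := ℝ)
    (mem_chart_source E x) v
  exact (continuousLinearMapAt_self (E := E) x _).symm.trans h

/-- Bisections with prescribed coordinate expressions: F and C are transported to M through the
charts. Taylor coefficients can then be prescribed by choosing F and C polynomial. -/
theorem exists_localBisection [CompleteSpace E] {x y : M} {F : E → E} {C : E → E →L[ℝ] E}
    (hF : ContDiff ℝ ∞ F) (hC : ContDiff ℝ ∞ C)
    (hFx : F (extChartAt 𝓘(ℝ, E) x x) = extChartAt 𝓘(ℝ, E) y y) (η : E ≃L[ℝ] E)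
    (hη : HasFDerivAt F (η : E →L[ℝ] E) (extChartAt 𝓘(ℝ, E) x x))
    (ξ : TangentSpace 𝓘(ℝ, E) x ≃L[ℝ] TangentSpace 𝓘(ℝ, E) y)
    (hξ : ∀ v : E, C (extChartAt 𝓘(ℝ, E) x x) v = ξ v) :
    ∃ b : LocalBisection E x y, b.value = ξ ∧
      b.baseRep =ᶠ[𝓝 (extChartAt 𝓘(ℝ, E) x x)] F ∧
      b.matrixRep =ᶠ[𝓝 (extChartAt 𝓘(ℝ, E) x x)] C := by
  classical
  let f : M → M := fun z => (extChartAt 𝓘(ℝ, E) y).symm (F (extChartAt 𝓘(ℝ, E) x z))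
  have hfx : f x = y := by
    simp only [f]
    rw [hFx, extChartAt_to_inv]
  let L : M → E →L[ℝ] E := fun z =>
    ((trivializationAt E (TangentSpace 𝓘(ℝ, E)) y).symmL ℝ (f z)).comp
      ((C (extChartAt 𝓘(ℝ, E) x z)).comp
        ((trivializationAt E (TangentSpace 𝓘(ℝ, E)) x).continuousLinearMapAt ℝ z))
  -- A bisection needs an isomorphism at every z, but `L z` is known to be invertible only near x;
  -- the identity is a filler elsewhere.
  let e : M → E ≃L[ℝ] E := fun z =>
    if h : (L z).IsInvertible then h.choose else ContinuousLinearEquiv.refl ℝ E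
  have he : ∀ z, (L z).IsInvertible → (e z : E →L[ℝ] E) = L z := by
    intro z h
    simp only [e, dif_pos h]
    exact h.choose_spec
  let T : ∀ z : M, OneJet E z := fun z => ⟨f z, e z⟩
  have hdiffeo : IsLocalDiffeomorphAt 𝓘(ℝ, E) 𝓘(ℝ, E) ∞ f x := by
    have h1 : IsLocalDiffeomorphAt 𝓘(ℝ, E) 𝓘(ℝ, E) ∞ (extChartAt 𝓘(ℝ, E) x) x :=
      (chartDiffeomorph x).isLocalDiffeomorphAt _ _ _ (mem_extChartAt_source x)
    have h2 := isLocalDiffeomorphAt_of_hasFDerivAt hF η hη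
    have h3 : IsLocalDiffeomorphAt 𝓘(ℝ, E) 𝓘(ℝ, E) ∞ (extChartAt 𝓘(ℝ, E) y).symm
        (F (extChartAt 𝓘(ℝ, E) x x)) := by
      rw [hFx]
      exact (chartDiffeomorph y).symm.isLocalDiffeomorphAt _ _ _ (mem_extChartAt_target y)
    exact IsLocalDiffeomorphAt.comp _ _ (IsLocalDiffeomorphAt.comp _ _ h1 h2) h3
  have hcont : Filter.Tendsto (extChartAt 𝓘(ℝ, E) x) (𝓝 x) (𝓝 (extChartAt 𝓘(ℝ, E) x x)) :=
    continuousAt_extChartAt x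
  -- At x the matrix is ξ, and invertibility is an open condition.
  have hCinv : ∀ᶠ z in 𝓝 x, (C (extChartAt 𝓘(ℝ, E) x z)).IsInvertible := by
    have h1 : Filter.Tendsto (fun z => C (extChartAt 𝓘(ℝ, E) x z)) (𝓝 x)
        (𝓝 (C (extChartAt 𝓘(ℝ, E) x x))) := hC.continuous.continuousAt.tendsto.comp hcont
    refine h1.eventually (isOpen_setOf_isInvertible.mem_nhds ?_)
    exact ⟨(ξ : E ≃L[ℝ] E), ContinuousLinearMap.ext fun v => (hξ v).symm⟩
  have hFt : ∀ᶠ z in 𝓝 x, F (extChartAt 𝓘(ℝ, E) x z) ∈ (extChartAt 𝓘(ℝ, E) y).target := by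
    have h1 : Filter.Tendsto (fun z => F (extChartAt 𝓘(ℝ, E) x z)) (𝓝 x)
        (𝓝 (F (extChartAt 𝓘(ℝ, E) x x))) := hF.continuous.continuousAt.tendsto.comp hcont
    rw [hFx] at h1
    exact h1.eventually (eventually_mem_extChartAt_target y)
  have hgood : ∀ᶠ z in 𝓝 x, z ∈ (chartAt E x).source ∧ f z ∈ (chartAt E y).source ∧
      (e z : E →L[ℝ] E) = L z := by
    filter_upwards [chart_source_mem_nhds E x, hCinv, hFt] with z h1 h2 h3
    have h4 : f z ∈ (chartAt E y).source := by
      have := (extChartAt 𝓘(ℝ, E) y).map_target h3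
      rwa [extChartAt_source] at this
    exact ⟨h1, h4, he z ((isInvertible_symmL h4).comp (h2.comp
      (isInvertible_continuousLinearMapAt h1)))⟩
  have hcoords : ∀ᶠ z in 𝓝 x, coords T x z = C (extChartAt 𝓘(ℝ, E) x z) := by
    filter_upwards [hgood] with z hz
    obtain ⟨h1, h2, h3⟩ := hz
    ext v
    let w : E := (trivializationAt E (TangentSpace 𝓘(ℝ, E)) x).symmL ℝ z v
    have h4 : (trivializationAt E (TangentSpace 𝓘(ℝ, E)) x).continuousLinearMapAt ℝ z w = v :=
      Trivialization.continuousLinearMapAt_symmL (R := ℝ) _ h1 v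
    have h5 : (trivializationAt E (TangentSpace 𝓘(ℝ, E)) y).continuousLinearMapAt ℝ (f z) (L z w) =
        C (extChartAt 𝓘(ℝ, E) x z) v := by
      refine (Trivialization.continuousLinearMapAt_symmL (R := ℝ) _ h2 _).trans ?_
      exact congrArg (C (extChartAt 𝓘(ℝ, E) x z)) h4
    have h6 : ∀ y', y' = y →
        (trivializationAt E (TangentSpace 𝓘(ℝ, E)) y').continuousLinearMapAt ℝ (f z) (e z w) =
          C (extChartAt 𝓘(ℝ, E) x z) v := by
      rintro _ rfl
      rw [← h5, ← h3]
      rfl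
    exact h6 _ hfx
  have hsmooth : ∀ᶠ z in 𝓝 x, ContMDiffAt 𝓘(ℝ, E) 𝓘(ℝ, E →L[ℝ] E) ∞ (coords T x) z := by
    filter_upwards [hcoords.eventually_nhds, chart_source_mem_nhds E x] with z h1 h2
    refine ContMDiffAt.congr_of_eventuallyEq ?_ h1
    exact hC.contMDiff.contMDiffAt.comp z (contMDiffAt_extChartAt' h2)
  have hself : T x = ⟨y, ξ⟩ := by
    have h1 := hgood.self_of_nhds.2.2
    have h2 : ∀ v : E, e x v = ξ v := by
      intro v
      refine (congrArg (fun A : E →L[ℝ] E => A v) h1).trans ?_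
      have h3 : ∀ w, w = y → ((trivializationAt E (TangentSpace 𝓘(ℝ, E)) y).symmL ℝ w
          (C (extChartAt 𝓘(ℝ, E) x x) ((trivializationAt E
            (TangentSpace 𝓘(ℝ, E)) x).continuousLinearMapAt ℝ x v)) : E) = ξ v := by
        rintro _ rfl
        refine (symmL_self _ _).trans ?_
        refine Eq.trans ?_ (hξ v)
        exact congrArg (C (extChartAt 𝓘(ℝ, E) x x)) (continuousLinearMapAt_self x v)
      exact h3 _ hfx
    have h3 : ∀ w (ζ : E ≃L[ℝ] E), w = y → (∀ v : E, ζ v = ξ v) → (⟨w, ζ⟩ : OneJet E x) = ⟨y, ξ⟩ := by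
      rintro w ζ rfl h
      exact congrArg (Sigma.mk w) (ContinuousLinearEquiv.ext (funext h))
    exact h3 _ _ hfx h2
  have hs := tendsto_extChartAt_symm (E := E) x
  refine ⟨⟨T, ξ, hself, hdiffeo, hsmooth⟩, rfl, ?_, ?_⟩
  · filter_upwards [hs.eventually hFt, eventually_mem_extChartAt_target x] with u h1 h2
    rw [(extChartAt 𝓘(ℝ, E) x).right_inv h2] at h1
    simp only [LocalBisection.baseRep, LocalBisection.base, T, f]
    rw [(extChartAt 𝓘(ℝ, E) x).right_inv h2, (extChartAt 𝓘(ℝ, E) y).right_inv h1]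
  · filter_upwards [hs.eventually hcoords, eventually_mem_extChartAt_target x] with u h1 h2
    rw [(extChartAt 𝓘(ℝ, E) x).right_inv h2] at h1
    exact h1


/-! ### Holonomic jets -/

namespace LocalBisection

variable {x y : M} (b : LocalBisection E x y)

theorem eventually_mdifferentiableAt_base :
    ∀ᶠ z in 𝓝 x, MDifferentiableAt 𝓘(ℝ, E) 𝓘(ℝ, E) b.base z := by
  obtain ⟨Φ, hx, h⟩ := b.isLocalDiffeomorphAt
  filter_upwards [Φ.open_source.mem_nhds hx] with z hz
  have hd : IsLocalDiffeomorphAt 𝓘(ℝ, E) 𝓘(ℝ, E) ∞ b.base z := ⟨Φ, hz, h⟩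
  exact hd.mdifferentiableAt (by simp)

/-- The derivative of `baseRep`, as an expression in coordinates of the differential of the map
underlying `b`. -/
theorem eventually_hasFDerivAt_baseRep : ∀ᶠ z in 𝓝 x,
    HasFDerivAt b.baseRep
      (inTangentCoordinates 𝓘(ℝ, E) 𝓘(ℝ, E) id b.base (fun z => mfderiv 𝓘(ℝ, E) 𝓘(ℝ, E) b.base z) x z)
      (extChartAt 𝓘(ℝ, E) x z) := by
  have hrep : b.baseRep = extChartAt 𝓘(ℝ, E) (b.base x) ∘ b.base ∘ (extChartAt 𝓘(ℝ, E) x).symm := by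
    funext u
    simp only [baseRep, Function.comp_apply]
    rw [b.base_self]
  filter_upwards [b.eventually_mdifferentiableAt_base, b.eventually_mem_source] with z h h'
  obtain ⟨h₁, h₂⟩ := h'
  have h₂' : b.base z ∈ (chartAt E (b.base x)).source := by
    rw [b.base_self]
    exact h₂
  have hz : z ∈ (extChartAt 𝓘(ℝ, E) x).source := by rwa [extChartAt_source]
  have hzz := (extChartAt 𝓘(ℝ, E) x).left_inv hz
  rw [inTangentCoordinates_eq_mfderiv_comp (I := 𝓘(ℝ, E)) (I' := 𝓘(ℝ, E)) h₁ h₂', hrep]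
  have d1 := (mdifferentiableWithinAt_extChartAt_symm (I := 𝓘(ℝ, E))
    ((extChartAt 𝓘(ℝ, E) x).map_source hz)).hasMFDerivWithinAt
  have d3 := (mdifferentiableAt_extChartAt (I := 𝓘(ℝ, E)) h₂').hasMFDerivAt
  have d2 := h.hasMFDerivAt
  have hr : Set.range 𝓘(ℝ, E) = Set.univ := Set.range_id
  rw [hr] at d1 ⊢
  have d23 : ∀ z', z' = z → HasMFDerivAt 𝓘(ℝ, E) 𝓘(ℝ, E)
      (extChartAt 𝓘(ℝ, E) (b.base x) ∘ b.base) z' (id (α := E →L[ℝ] E)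
        ((mfderiv 𝓘(ℝ, E) 𝓘(ℝ, E) (extChartAt 𝓘(ℝ, E) (b.base x)) (b.base z)).comp
          (mfderiv 𝓘(ℝ, E) 𝓘(ℝ, E) b.base z))) := by
    rintro _ rfl
    exact d3.comp _ d2
  exact ((d23 _ hzz).comp _ (hasMFDerivWithinAt_univ.1 d1)).hasFDerivAt

/-- Both matrices arise by composing with the same invertible chart derivatives on the two sides. -/
theorem coords_eq_iff : ∀ᶠ z in 𝓝 x,
    (coords b.toFun x z = inTangentCoordinates 𝓘(ℝ, E) 𝓘(ℝ, E) id b.base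
        (fun z => mfderiv 𝓘(ℝ, E) 𝓘(ℝ, E) b.base z) x z ↔
      ((b.toFun z).2 : TangentSpace 𝓘(ℝ, E) z →L[ℝ] TangentSpace 𝓘(ℝ, E) (b.toFun z).1) =
        mfderiv 𝓘(ℝ, E) 𝓘(ℝ, E) b.base z) := by
  filter_upwards [b.eventually_mem_source] with z h'
  obtain ⟨h₁, h₂⟩ := h'
  have h₂' : b.base z ∈ (chartAt E (b.base x)).source := by
    rw [b.base_self]
    exact h₂
  unfold coords
  have e1 := inTangentCoordinates_eq_mfderiv_comp (I := 𝓘(ℝ, E)) (I' := 𝓘(ℝ, E))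
    (f := id) (g := b.base) (x₀ := x) (x := z)
    (ϕ := fun z => mfderiv 𝓘(ℝ, E) 𝓘(ℝ, E) b.base z) h₁ h₂'
  have e2 := inTangentCoordinates_eq_mfderiv_comp (I := 𝓘(ℝ, E)) (I' := 𝓘(ℝ, E))
    (f := id) (g := fun z => (b.toFun z).1) (x₀ := x) (x := z)
    (ϕ := fun z => ((b.toFun z).2 :
      TangentSpace 𝓘(ℝ, E) z →L[ℝ] TangentSpace 𝓘(ℝ, E) (b.toFun z).1)) h₁ h₂'
  constructor
  · intro h
    have h3 := e2.symm.trans (h.trans e1)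
    have i1 := isInvertible_mfderiv_extChartAt (I := 𝓘(ℝ, E)) (x := b.base x) (y := b.base z)
      (by rwa [extChartAt_source])
    have i2 := isInvertible_mfderivWithin_extChartAt_symm (I := 𝓘(ℝ, E)) (x := x)
      (y := extChartAt 𝓘(ℝ, E) x z) ((extChartAt 𝓘(ℝ, E) x).map_source (by rwa [extChartAt_source]))
    have key : ∀ (P Q L L' : E →L[ℝ] E), P.IsInvertible → Q.IsInvertible →
        P.comp (L.comp Q) = P.comp (L'.comp Q) → L = L' := by
      rintro _ _ L L' ⟨P, rfl⟩ ⟨Q, rfl⟩ h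
      ext v
      have := congrArg (fun A : E →L[ℝ] E => A (Q.symm v)) h
      simpa using this
    exact key _ _ _ _ i1 i2 h3
  · intro h
    refine e2.trans (Eq.trans ?_ e1.symm)
    rw [h]
    rfl

variable {b}

/-- For a holonomic representative the matrix of b(z) is the derivative of f in coordinates
throughout a neighbourhood of x, so B is a second derivative. -/
theorem secondOrder_symm_of_isHolonomic (h : b.jet.IsHolonomic) (u v : E) :
    b.secondOrder u v = b.secondOrder v u := by
  obtain ⟨b', hb', h⟩ := h
  have e : b'.secondOrder = b.secondOrder := congrArg (fun t => t.2.2) (jet_eq_iff.1 hb')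
  rw [← e]
  have h1 : ∀ᶠ z in 𝓝 x, HasFDerivAt b'.baseRep (coords b'.toFun x z) (extChartAt 𝓘(ℝ, E) x z) := by
    filter_upwards [h, b'.coords_eq_iff, b'.eventually_hasFDerivAt_baseRep] with z h1 h2 h3
    rw [h2.2 h1]
    exact h3
  have h2 : ∀ᶠ u in 𝓝 (extChartAt 𝓘(ℝ, E) x x), HasFDerivAt b'.baseRep (b'.matrixRep u) u := by
    filter_upwards [(tendsto_extChartAt_symm x).eventually h1,
      eventually_mem_extChartAt_target x] with u h2 h3
    rw [(extChartAt 𝓘(ℝ, E) x).right_inv h3] at h2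
    exact h2
  exact second_derivative_symmetric_of_eventually_of_real h2 b'.hasFDerivAt_matrixRep u v

theorem taylor_ext {b b' : LocalBisection E x y} (h₁ : b.value = b'.value)
    (h₂ : b.derivMap = b'.derivMap) (h₃ : b.secondOrder = b'.secondOrder) :
    b.taylor = b'.taylor :=
  Prod.ext h₁ (Prod.ext h₂ h₃)

theorem isHolonomic_of_secondOrder_symm [CompleteSpace E] (hb : b.jet.IsSemiholonomic)
    (h : ∀ u v : E, b.secondOrder u v = b.secondOrder v u) : b.jet.IsHolonomic := by
  let a : E := extChartAt 𝓘(ℝ, E) x x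
  -- The second order Taylor polynomial of the wanted map; `C` is its derivative, by the symmetry of
  -- B.
  let F : E → E := fun u => extChartAt 𝓘(ℝ, E) y y +
    (b.valueMap (u - a) + (1 / 2 : ℝ) • b.secondOrder (u - a) (u - a))
  let C : E → E →L[ℝ] E := fun u => b.valueMap + b.secondOrder (u - a)
  have hsub : ContDiff ℝ ∞ fun u : E => u - a := contDiff_id.sub contDiff_const
  have hC : ContDiff ℝ ∞ C := contDiff_const.add (b.secondOrder.contDiff.comp hsub)
  have hF : ContDiff ℝ ∞ F := contDiff_const.add ((b.valueMap.contDiff.comp hsub).add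
    (contDiff_const.smul ((b.secondOrder.contDiff.comp hsub).clm_apply hsub)))
  have hF' : ∀ u, HasFDerivAt F (C u) u := by
    intro u
    have h1 : HasFDerivAt (fun u : E => u - a) (ContinuousLinearMap.id ℝ E) u :=
      (hasFDerivAt_id u).sub_const a
    have h2 := (b.valueMap.hasFDerivAt.comp u h1).add
      (((b.secondOrder.hasFDerivAt.comp u h1).clm_apply h1).const_smul (1 / 2 : ℝ))
    refine (h2.const_add (extChartAt 𝓘(ℝ, E) y y)).congr_fderiv ?_
    ext w
    simp only [C, add_apply, smul_apply,
      ContinuousLinearMap.comp_apply, ContinuousLinearMap.id_apply, ContinuousLinearMap.flip_apply,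
      Function.comp_apply]
    rw [h w (u - a)]
    module
  have hC' : HasFDerivAt C b.secondOrder a :=
    ((b.secondOrder.hasFDerivAt.comp a ((hasFDerivAt_id a).sub_const a))).const_add b.valueMap
  have hCa : ∀ v : E, C a v = b.value v := by
    intro v
    simp only [C, sub_self, map_zero, add_zero]
    rfl
  have hFa : F a = extChartAt 𝓘(ℝ, E) y y := by
    simp [F]
  have hCv : C a = b.valueMap := by simp [C]
  obtain ⟨b', hval, hbase, hmat⟩ := exists_localBisection hF hC hFa (b.value : E ≃L[ℝ] E)
    (by
      have := hF' a
      rw [hCv] at this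
      exact this) b.value hCa
  refine ⟨b', jet_eq_iff.2 (taylor_ext hval ?_ ?_), ?_⟩
  · have h1 := b'.hasFDerivAt_baseRep.unique ((hF' a).congr_of_eventuallyEq hbase)
    rw [hCv] at h1
    exact h1.trans hb
  · exact b'.hasFDerivAt_matrixRep.unique (hC'.congr_of_eventuallyEq hmat)
  -- Holonomy is needed on a neighbourhood of x: there the base map is `F` and the matrix is `C`,
  -- the derivative of `F`.
  · have hcont : Filter.Tendsto (extChartAt 𝓘(ℝ, E) x) (𝓝 x) (𝓝 a) := continuousAt_extChartAt x
    filter_upwards [b'.coords_eq_iff, b'.eventually_hasFDerivAt_baseRep,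
      hcont.eventually hbase.eventuallyEq_nhds, hcont.eventually hmat,
      extChartAt_source_mem_nhds (I := 𝓘(ℝ, E)) x] with z h1 h2 h3 h4 h5
    refine h1.1 ?_
    have h6 := h2.unique ((hF' _).congr_of_eventuallyEq h3)
    rw [h6, ← h4]
    unfold matrixRep
    rw [(extChartAt 𝓘(ℝ, E) x).left_inv h5]

end LocalBisection

/-! ### Existence and uniqueness of affine extensions -/

section FiniteDimensional

variable [FiniteDimensional ℝ E] {D : Connection E M} {x y : M}

theorem existsUnique_isAffine (D : Connection E M)
    (ξ : TangentSpace 𝓘(ℝ, E) x ≃L[ℝ] TangentSpace 𝓘(ℝ, E) y) :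
    ∃! S : Jet11 E x y, IsAffine D S ∧ S.p = ξ := by
  have : CompleteSpace E := FiniteDimensional.complete ℝ E
  obtain ⟨Γ, hΓ⟩ := exists_isChristoffel D x
  obtain ⟨Γ', hΓ'⟩ := exists_isChristoffel D y
  let a : E := extChartAt 𝓘(ℝ, E) x x
  let ζ : E ≃L[ℝ] E := ξ
  let A : E →L[ℝ] E := ζ
  -- The value forced by `isAffine_jet_iff`, as a continuous bilinear map.
  let B : E →L[ℝ] E →L[ℝ] E := (ContinuousLinearMap.compL ℝ E E E A).comp Γ.flip -
    ((ContinuousLinearMap.compL ℝ E E E).flip A).comp (Γ'.flip.comp A)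
  have hB : ∀ X Y : E, B X Y = A (Γ Y X) - Γ' (A Y) (A X) := fun X Y => rfl
  -- Semi-holonomy constrains only the derivative at x, so an affine-linear base map suffices even
  -- though `C` varies.
  let F : E → E := fun u => extChartAt 𝓘(ℝ, E) y y + A (u - a)
  let C : E → E →L[ℝ] E := fun u => A + B (u - a)
  have hsub : ContDiff ℝ ∞ fun u : E => u - a := contDiff_id.sub contDiff_const
  have hC : ContDiff ℝ ∞ C := contDiff_const.add (B.contDiff.comp hsub)
  have hF : ContDiff ℝ ∞ F := contDiff_const.add (A.contDiff.comp hsub)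
  have hF' : HasFDerivAt F A a :=
    (A.hasFDerivAt.comp a ((hasFDerivAt_id a).sub_const a)).const_add _
  have hC' : HasFDerivAt C B a :=
    (B.hasFDerivAt.comp a ((hasFDerivAt_id a).sub_const a)).const_add A
  have hCa : ∀ v : E, C a v = ξ v := by
    intro v
    simp only [C, sub_self, map_zero, add_zero]
    rfl
  have hFa : F a = extChartAt 𝓘(ℝ, E) y y := by
    simp [F]
  obtain ⟨b, hval, hbase, hmat⟩ := exists_localBisection hF hC hFa ζ hF' ξ hCa
  have hder : b.derivMap = A :=
    b.hasFDerivAt_baseRep.unique (hF'.congr_of_eventuallyEq hbase)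
  have hsec : b.secondOrder = B :=
    b.hasFDerivAt_matrixRep.unique (hC'.congr_of_eventuallyEq hmat)
  have hvm : ∀ b : LocalBisection E x y, b.value = ξ → b.valueMap = A := by
    intro b h
    unfold LocalBisection.valueMap
    rw [h]
    rfl
  refine ⟨b.jet, ⟨(isAffine_jet_iff hΓ hΓ' b).2 ⟨?_, ?_⟩, hval⟩, ?_⟩
  · rw [hder, hvm b hval]
  · rw [hsec, hvm b hval]
    exact hB
  · rintro S ⟨hS, hp⟩
    obtain ⟨b', rfl⟩ := S.exists_rep
    have hp' : b'.value = ξ := hp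
    obtain ⟨h1, h2⟩ := (isAffine_jet_iff hΓ hΓ' b').1 hS
    refine LocalBisection.jet_eq_iff.2 (LocalBisection.taylor_ext (hp'.trans hval.symm) ?_ ?_)
    · rw [hder, ← h1, hvm b' hp']
    · ext X Y
      rw [h2, hsec, hB, hvm b' hp']

/-- For an affine jet, B(X)Y - B(Y)X = ξT(X, Y) - T(ξX, ξY), so B is symmetric exactly when ξ
preserves the torsion. -/
theorem IsAffine.isHolonomic_iff {S : Jet11 E x y} (hS : IsAffine D S) :
    S.IsHolonomic ↔ ∀ X Y : TangentSpace 𝓘(ℝ, E) x,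
      S.p (D.torsion x X Y) = D.torsion y (S.p X) (S.p Y) := by
  have : CompleteSpace E := FiniteDimensional.complete ℝ E
  obtain ⟨b, rfl⟩ := S.exists_rep
  obtain ⟨Γ, hΓ⟩ := exists_isChristoffel D x
  obtain ⟨Γ', hΓ'⟩ := exists_isChristoffel D y
  obtain ⟨-, h⟩ := (isAffine_jet_iff hΓ hΓ' b).1 hS
  have key : ∀ X Y : E, b.secondOrder X Y - b.secondOrder Y X =
      b.valueMap (Γ Y X - Γ X Y) -
        (Γ' (b.valueMap Y) (b.valueMap X) - Γ' (b.valueMap X) (b.valueMap Y)) := by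
    intro X Y
    rw [h, h, map_sub]
    abel
  have key' : ∀ X Y : TangentSpace 𝓘(ℝ, E) x,
      b.jet.p (D.torsion x X Y) = D.torsion y (b.jet.p X) (b.jet.p Y) ↔
        b.secondOrder X Y = b.secondOrder Y X := by
    intro X Y
    rw [hΓ.torsion_eq, hΓ'.torsion_eq]
    have h1 : ∀ X Y : E, b.valueMap (Γ Y X - Γ X Y) =
        Γ' (b.valueMap Y) (b.valueMap X) - Γ' (b.valueMap X) (b.valueMap Y) ↔
        b.secondOrder X Y = b.secondOrder Y X := by
      intro X Y
      rw [← sub_eq_zero, ← key, sub_eq_zero]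
    exact h1 X Y
  constructor
  · intro hh X Y
    exact (key' X Y).2 (LocalBisection.secondOrder_symm_of_isHolonomic hh X Y)
  · intro hh
    exact LocalBisection.isHolonomic_of_secondOrder_symm hS.1 fun u v => (key' u v).1 (hh u v)

end FiniteDimensional

end AffineJet

end

theorem proposition4p1 {E : Type*} [NormedAddCommGroup E] [NormedSpace ℝ E] [FiniteDimensional ℝ E]
    {M : Type*} [TopologicalSpace M] [ChartedSpace E M] [IsManifold 𝓘(ℝ, E) ∞ M]
    (D : Connection E M) :
    -- every 1-jet has exactly one affine extension
    (∀ (x y : M) (ξ : TangentSpace 𝓘(ℝ, E) x ≃L[ℝ] TangentSpace 𝓘(ℝ, E) y),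
      ∃! S : Jet11 E x y, IsAffine D S ∧ S.p = ξ) ∧
    -- the defect of holonomy of an affine jet is the defect of invariance of the torsion
    (∀ (x y : M) (S : Jet11 E x y), IsAffine D S →
      (∀ 𝒳 : T2 E x, T2.SameFiber (S.act 𝒳) (S.kappaAct 𝒳) ∧
        T2.diff (S.act 𝒳) (S.kappaAct 𝒳) =
          S.p (D.torsion x 𝒳.pStar 𝒳.p) - D.torsion y (S.p 𝒳.pStar) (S.p 𝒳.p)) ∧
      (S.IsHolonomic ↔ ∀ X Y : TangentSpace 𝓘(ℝ, E) x,
        S.p (D.torsion x X Y) = D.torsion y (S.p X) (S.p Y))) ∧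
    -- the torsion of the connection of a symmetry jet
    (∀ s : SymmetryJet E M, s.Induces D → ∀ (x : M) (𝒳 : T2 E x),
      T2.SameFiber ((s.toFun x).kappaAct 𝒳) ((s.toFun x).act 𝒳) ∧
        D.torsion x 𝒳.pStar 𝒳.p =
          (1 / 2 : ℝ) • T2.diff ((s.toFun x).kappaAct 𝒳) ((s.toFun x).act 𝒳)) := by
  refine ⟨fun x y ξ => existsUnique_isAffine D ξ, fun x y S hS => ⟨hS.sameFiber_and_diff_eq,
    hS.isHolonomic_iff⟩, fun s hs => hs.sameFiber_and_torsion_eq⟩
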